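/- **Proposition (Random matrix interpretation of microstates free entropy).** *Setting.* Let $n\ge 1$, let $(\mathcal A,\tau)$ be a noncommutative probability space (a complex unital $*$-algebra with a unital, tracial, positive linear functional), and let $X=(X_1,\dots,X_n)$ be a tuple of self-adjoint elements of $\mathcal A$ that are bounded in operator norm, i.e. for each $j$ there is $R$ with $\tau((X_jb)^*(X_jb))\le R^2\tau(b^*b)$ for all $b\in\mathcal A$ (automatic if $\mathcal A$ is a $C^*$-algebra). Its noncommutative law is $\lambda_X(p)=\tau(p(X))$ on the $*$-algebra $\mathbb C\langle x_1,\dots,x_n\rangle$ of noncommutative polynomials in self-adjoint variables. For $N\ge1$ let $M_N(\mathbb C)_{\rm sa}^n$ be the space of $n$-tuples of Hermitian $N\times N$ matrices with inner product $\langle Y,Z\rangle=\sum_j \mathrm{tr}_N(Y_jZ_j)$, $\mathrm{tr}_N=\frac1N\mathrm{Tr}$, norm $\|Y\|$, associated Lebesgue (Haar) measure $\nu_N$ giving mass $1$ to the unit cube of an orthonormal basis, and $\|Y\|_{\rm op}=\max_j\|Y_j\|_{\rm op}$; put $\lambda_Y(p)=\mathrm{tr}_N(p(Y))$. *Microstates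 free entropy.* For $R>0$ let $\Sigma_{n,R}$ be the set of positive tracial linear functionals $\lambda$ on $\mathbb C\langle x_1,\dots,x_n\rangle$ with $|\lambda(x_{i_1}\cdots x_{i_l})|\le R^l$ for all $l$ and all $i_1,\dots,i_l$, with the weak-$*$ topology. For open $\mathcal U\subseteq\Sigma_{n,R}$ let $\Gamma_R^{(N)}(\mathcal U)=\{Y\in M_N(\mathbb C)_{\rm sa}^n:\lambda_Y\in\mathcal U\}$, and for $\lambda\in\Sigma_{n,R}$ let $$\chi_R(\lambda)=\inf_{\mathcal U\ni\lambda}\limsup_{N\to\infty}\Big(\frac1{N^2}\log\nu_N\big(\Gamma_R^{(N)}(\mathcal U)\big)+n\log N\Big)$$ with the infimum over open neighbourhoods of $\lambda$ in $\Sigma_{n,R}$. Let $\chi(\lambda)=\sup_R\chi_R(\lambda)$ over all $R>0$ with $\lambda\in\Sigma_{n,R}$, and $\chi(X)=\chi(\lambda_X)\in[-\infty,\infty]$. *Classical entropy.* For a random tuple $Y$ in $M_N(\mathbb C)_{\rm sa}^n$ with density $\rho$ with respect to $\nu_N$ let $h(Y)=-\int\rho\log\rho\,d\nu_N$, and $h(Y)=-\infty$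 if there is no density; let $h^{(N)}(Y)=\frac1{N^2}h(Y)+n\log N$. *Statement.* $\chi(X)$ is the supremum (in $[-\infty,\infty]$, with $\sup\emptyset=-\infty$) of $$\limsup_{\ell\to\infty}h^{(N_\ell)}(X^{(\ell)})$$ over all sequences of positive integers $N_\ell\to\infty$ and all sequences of random tuples $X^{(\ell)}$ in $M_{N_\ell}(\mathbb C)_{\rm sa}^n$ such that 1. $\lambda_{X^{(\ell)}}\to\lambda_X$ in probability, for the weak-$*$ topology; 2. for some $R>0$, $\limsup_{\ell\to\infty}\|X^{(\ell)}\|_{\rm op}\le R$ in probability, i.e. $P(\|X^{(\ell)}\|_{\rm op}\ge R+\varepsilon)\to0$ for every $\varepsilon>0$; 3. there are constants $C,K>0$ with $P(\|X^{(\ell)}\|\ge C+\delta)\le e^{-KN_\ell^2\delta^2}$ for all $\ell$ and all $\delta>0$. Moreover, if $\chi(X)>-\infty$, the supremum is attained by a sequence satisfying (1)–(3) such that, for some $R$, $\|X^{(\ell)}\|_{\rm op}\le R$ almost surely for all $\ell$, and such that the distribution of every $X^{(\ell)}$ is invariant under simultaneous conjugation by unitary matrices. -/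

import Mathlib

noncomputable section

namespace Microstates

open MeasureTheory Filter Topology
open scoped ENNReal

/-! ### Noncommutative polynomials, tracial functionals and laws -/

/-- `ℂ⟨x₁, …, xₙ⟩`: noncommutative polynomials, i.e. finite `ℂ`-linear combinations of words
in the letters `x₁, …, xₙ`. -/
abbrev NCPoly (n : ℕ) : Type := MonoidAlgebra ℂ (FreeMonoid (Fin n))

/-- The word `x_{i₁} ⋯ x_{i_l}` as a noncommutative polynomial. -/
def ncWord {n : ℕ} (w : FreeMonoid (Fin n)) : NCPoly n := MonoidAlgebra.single w 1

/-- The `*`-operation of `ℂ⟨x₁, …, xₙ⟩` for which every `xᵢ` is self-adjoint: words are reversed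
and coefficients are conjugated. -/
def ncStar {n : ℕ} (p : NCPoly n) : NCPoly n :=
  p.coeff.sum fun w c => MonoidAlgebra.single w.reverse (star c)

/-- Evaluation `p ↦ p(X)` at an `n`-tuple `X` of elements of a complex algebra. -/
def ncEval {n : ℕ} {A : Type*} [Ring A] [Algebra ℂ A] (X : Fin n → A) : NCPoly n →ₐ[ℂ] A :=
  MonoidAlgebra.lift ℂ A (FreeMonoid (Fin n)) (FreeMonoid.lift X)

/-- Linear functionals on `ℂ⟨x₁, …, xₙ⟩`. -/
abbrev NCFunctional (n : ℕ) : Type := NCPoly n →ₗ[ℂ] ℂ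

/-- The weak-`*` topology: pointwise convergence on noncommutative polynomials. -/
instance instTopologicalSpaceNCFunctional (n : ℕ) : TopologicalSpace (NCFunctional n) :=
  TopologicalSpace.induced (fun (lam : NCFunctional n) (p : NCPoly n) => lam p) Pi.topologicalSpace

open scoped ComplexOrder in
/-- `τ` is a unital tracial positive linear functional on the unital `*`-algebra `A`, so that
`(A, τ)` is a noncommutative probability space. -/
structure IsTracialState {A : Type*} [Ring A] [StarRing A] [Algebra ℂ A] (τ : A →ₗ[ℂ] ℂ) :
    Prop where
  unital : τ 1 = 1
  positive : ∀ a : A, 0 ≤ τ (star a * a)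
  tracial : ∀ a b : A, τ (a * b) = τ (b * a)

/-- `a` acts by left multiplication on `L²(A, τ)` with operator norm at most `R`:
`‖a b‖_{L²(τ)} ≤ R ‖b‖_{L²(τ)}` for all `b ∈ A`. -/
def OpNormLE {A : Type*} [Ring A] [StarRing A] [Algebra ℂ A] (τ : A →ₗ[ℂ] ℂ) (a : A) (R : ℝ) :
    Prop :=
  0 ≤ R ∧ ∀ b : A, (τ (star (a * b) * (a * b))).re ≤ R ^ 2 * (τ (star b * b)).re

open scoped ComplexOrder in
/-- The space `Σ_{n,R}` of tracial positive linear functionals `λ` on `ℂ⟨x₁, …, xₙ⟩` with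
`|λ(x_{i₁} ⋯ x_{i_l})| ≤ R ^ l` for all words. As a subtype of `NCFunctional n` it carries
the weak-`*` topology. -/
def lawSpace (n : ℕ) (R : ℝ) : Set (NCFunctional n) :=
  {lam | (∀ p : NCPoly n, 0 ≤ lam (ncStar p * p)) ∧
    (∀ p q : NCPoly n, lam (p * q) = lam (q * p)) ∧
    ∀ w : FreeMonoid (Fin n), ‖lam (ncWord w)‖ ≤ R ^ w.length}

/-- The noncommutative law `λ_X(p) = τ(p(X))` of a tuple `X`. -/
def ncLaw {n : ℕ} {A : Type*} [Ring A] [Algebra ℂ A] (τ : A →ₗ[ℂ] ℂ) (X : Fin n → A) :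
    NCFunctional n :=
  τ ∘ₗ (ncEval X).toLinearMap

/-! ### The inner product space `M_N(ℂ)_sa ^ n` -/

/-- The space `M_N(ℂ)_sa ^ n` of `n`-tuples of Hermitian `N × N` matrices. -/
def HermTuple (N n : ℕ) : Type := Fin n → selfAdjoint (Matrix (Fin N) (Fin N) ℂ)

namespace HermTuple

variable {N n : ℕ}

instance instAddCommGroup : AddCommGroup (HermTuple N n) :=
  inferInstanceAs (AddCommGroup (Fin n → selfAdjoint (Matrix (Fin N) (Fin N) ℂ)))

instance instModule : Module ℝ (HermTuple N n) :=
  inferInstanceAs (Module ℝ (Fin n → selfAdjoint (Matrix (Fin N) (Fin N) ℂ)))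

/-- The `j`-th component of a tuple, as a matrix. -/
def mat (Y : HermTuple N n) (j : Fin n) : Matrix (Fin N) (Fin N) ℂ := (Y j).1

theorem mat_isHermitian (Y : HermTuple N n) (j : Fin n) : (Y.mat j).IsHermitian := (Y j).2

@[simp] theorem mat_add (X Y : HermTuple N n) (j : Fin n) :
    (X + Y).mat j = X.mat j + Y.mat j := rfl

@[simp] theorem mat_smul (r : ℝ) (Y : HermTuple N n) (j : Fin n) :
    (r • Y).mat j = r • Y.mat j := rfl

theorem ext_mat {X Y : HermTuple N n} (h : ∀ j, X.mat j = Y.mat j) : X = Y :=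
  funext fun j => Subtype.ext (h j)

theorem trace_mat_mul_self_re (Y : HermTuple N n) (j : Fin n) :
    (Matrix.trace (Y.mat j * Y.mat j)).re = ∑ a, ∑ b, ‖Y.mat j a b‖ ^ 2 := by
  simp only [Matrix.trace, Matrix.diag_apply, Matrix.mul_apply, Complex.re_sum]
  refine Finset.sum_congr rfl fun a _ => Finset.sum_congr rfl fun b _ => ?_
  rw [← (Y.mat_isHermitian j).apply b a, Complex.star_def, Complex.mul_conj,
    Complex.normSq_eq_norm_sq, Complex.ofReal_re]

/-- The inner product `⟨X, Y⟩ = ∑ⱼ tr_N(Xⱼ Yⱼ)` with the normalized trace `tr_N = (1/N) Tr`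
(these traces are real). -/
@[reducible] def innerCore (N n : ℕ) : InnerProductSpace.Core ℝ (HermTuple N n) where
  inner X Y := ∑ j, (N : ℝ)⁻¹ * (Matrix.trace (X.mat j * Y.mat j)).re
  conj_inner_symm X Y := by
    simp only [conj_trivial]
    exact Finset.sum_congr rfl fun j _ => by rw [Matrix.trace_mul_comm]
  re_inner_nonneg X := by
    change 0 ≤ ∑ j, (N : ℝ)⁻¹ * (Matrix.trace (X.mat j * X.mat j)).re
    refine Finset.sum_nonneg fun j _ => mul_nonneg (by positivity) ?_
    rw [trace_mat_mul_self_re]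
    positivity
  add_left X Y Z := by
    simp [add_mul, mul_add, Finset.sum_add_distrib]
  smul_left X Y r := by
    simp [Finset.mul_sum, mul_left_comm]
  definite X h := by
    refine ext_mat fun j => ?_
    change ∑ j, (N : ℝ)⁻¹ * (Matrix.trace (X.mat j * X.mat j)).re = 0 at h
    have hj : (N : ℝ)⁻¹ * (Matrix.trace (X.mat j * X.mat j)).re = 0 := by
      refine (Finset.sum_eq_zero_iff_of_nonneg fun i _ => mul_nonneg (by positivity) ?_).1 h j
        (Finset.mem_univ j)
      rw [trace_mat_mul_self_re]
      positivity
    ext a b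
    have hN : (N : ℝ)⁻¹ ≠ 0 := inv_ne_zero (Nat.cast_ne_zero.2 (Fin.pos a).ne')
    have ht := (mul_eq_zero.1 hj).resolve_left hN
    rw [trace_mat_mul_self_re] at ht
    have h1 := (Finset.sum_eq_zero_iff_of_nonneg fun a _ => by positivity).1 ht a
      (Finset.mem_univ a)
    have h2 := (Finset.sum_eq_zero_iff_of_nonneg fun b _ => by positivity).1 h1 b
      (Finset.mem_univ b)
    have h3 : X.mat j a b = 0 := by simpa using h2
    rw [h3]
    rfl

instance instNormedAddCommGroup : NormedAddCommGroup (HermTuple N n) :=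
  (innerCore N n).toNormedAddCommGroup

instance instInnerProductSpace : InnerProductSpace ℝ (HermTuple N n) :=
  InnerProductSpace.ofCore (innerCore N n).toCore

instance instFiniteDimensional : FiniteDimensional ℝ (HermTuple N n) :=
  FiniteDimensional.of_injective
    ({ toFun := fun Y => Y.mat, map_add' := fun _ _ => rfl, map_smul' := fun _ _ => rfl } :
      HermTuple N n →ₗ[ℝ] (Fin n → Matrix (Fin N) (Fin N) ℂ))
    fun _ _ h => ext_mat fun j => congrFun h j

instance instMeasurableSpace : MeasurableSpace (HermTuple N n) := borel _

instance instBorelSpace : BorelSpace (HermTuple N n) := ⟨rfl⟩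

/-- The operator norm `‖Y‖_op = maxⱼ ‖Yⱼ‖_op` of a tuple, where `‖Yⱼ‖_op` is the norm of `Yⱼ` as an
operator on the Hilbert space `ℂ^N`. -/
def opNorm (Y : HermTuple N n) : ℝ := ⨆ j, ‖Matrix.toEuclideanCLM (𝕜 := ℂ) (Y.mat j)‖

/-- The tuple `(U Y₁ U*, …, U Yₙ U*)`. -/
def unitaryConj (U : Matrix.unitaryGroup (Fin N) ℂ) (Y : HermTuple N n) : HermTuple N n :=
  fun j => ⟨U.1 * Y.mat j * star U.1, (Y j).2.conjugate U.1⟩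

end HermTuple

/-- The normalized trace `tr_N = (1/N) Tr` on `M_N(ℂ)`. -/
def normTrace (N : ℕ) : Matrix (Fin N) (Fin N) ℂ →ₗ[ℂ] ℂ :=
  (N : ℂ)⁻¹ • Matrix.traceLinearMap (Fin N) ℂ ℂ

/-- The noncommutative law `λ_Y(p) = tr_N(p(Y))` of a tuple of Hermitian matrices. -/
def matLaw {N n : ℕ} (Y : HermTuple N n) : NCFunctional n := ncLaw (normTrace N) Y.mat

/-! ### Microstates free entropy -/

/-- The microstate space `Γ_R^{(N)}(𝒰)`, for a set `𝒰` of `Σ_{n,R}`. -/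
def microstateSpace {n : ℕ} {R : ℝ} (𝒰 : Set (lawSpace n R)) (N : ℕ) : Set (HermTuple N n) :=
  {Y | ∃ h : matLaw Y ∈ lawSpace n R, (⟨matLaw Y, h⟩ : lawSpace n R) ∈ 𝒰}

/-- `χ_R(λ) = inf_{𝒰 ∋ λ} limsup_N (N⁻² log ν(Γ_R^{(N)}(𝒰)) + n log N)`, the infimum being over the
open neighbourhoods of `λ` in `Σ_{n,R}`. Here `volume` is the Haar measure `ν` of the inner product
space `M_N(ℂ)_sa ^ n`, and `log 0 = -∞`. -/
def chiR {n : ℕ} {R : ℝ} (lam : lawSpace n R) : EReal :=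
  ⨅ (𝒰 : Set (lawSpace n R)) (_ : IsOpen 𝒰) (_ : lam ∈ 𝒰),
    limsup (fun N : ℕ =>
      ((((N : ℝ) ^ 2)⁻¹ : ℝ) : EReal) *
          ENNReal.log (volume (microstateSpace 𝒰 N : Set (HermTuple N n)))
        + ((n * Real.log N : ℝ) : EReal)) atTop

/-- `χ(λ)`, the supremum of `χ_R(λ)` over the `R > 0` for which `λ` lies in `Σ_{n,R}` (this set
of `R` is upward closed and `χ_R(λ)` is nondecreasing in `R`). -/
def chi {n : ℕ} (lam : NCFunctional n) : EReal :=
  ⨆ (R : ℝ) (_ : 0 < R) (h : lam ∈ lawSpace n R), chiR (⟨lam, h⟩ : lawSpace n R)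

/-! ### Classical entropy -/

/-- The classical differential entropy `-∫ ρ log ρ` of a law `μ` with density `ρ` on a finite
dimensional inner product space, as the difference of the integrals of the positive and the
negative part of `-ρ log ρ` in `[-∞, ∞]`; it is `-∞` if there is no density. (If both parts
have infinite integral, which does not happen for laws of finite variance, `∞ - ∞ = -∞` is used.) -/
def entropy {H : Type*} [NormedAddCommGroup H] [InnerProductSpace ℝ H] [FiniteDimensional ℝ H]
    [MeasurableSpace H] [BorelSpace H] (μ : Measure H) : EReal :=
  open Classical in
  if μ ≪ (volume : Measure H) then
    ((∫⁻ x, ENNReal.ofReal (Real.negMulLog (μ.rnDeriv volume x).toReal) : ℝ≥0∞) : EReal)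
      - ((∫⁻ x, ENNReal.ofReal (-Real.negMulLog (μ.rnDeriv volume x).toReal) : ℝ≥0∞) : EReal)
  else ⊥

/-- The normalized classical entropy `h^{(N)} = N⁻² h + n log N` on `M_N(ℂ)_sa ^ n`. -/
def normEntropy {N n : ℕ} (μ : Measure (HermTuple N n)) : EReal :=
  ((((N : ℝ) ^ 2)⁻¹ : ℝ) : EReal) * entropy μ + ((n * Real.log N : ℝ) : EReal)

/-! ### Random matrix models -/

/-- `μ ℓ` is the law of a random tuple `X^{(ℓ)}` in `M_{N_ℓ}(ℂ)_sa ^ n`, where `N_ℓ → ∞`. These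
random tuples converge to `λ` in noncommutative law in probability, are asymptotically bounded in
operator norm, and have Gaussian tails. -/
structure IsMatrixModel {n : ℕ} (lam : NCFunctional n) (N : ℕ → ℕ)
    (μ : (l : ℕ) → Measure (HermTuple (N l) n)) : Prop where
  size_pos : ∀ l, 0 < N l
  size_tendsto : Tendsto N atTop atTop
  isProb : ∀ l, IsProbabilityMeasure (μ l)
  /-- The laws `λ_{X^{(ℓ)}}` converge to `λ` in probability, for the weak-`*` topology. -/
  tendsto_law : ∀ 𝒰 : Set (NCFunctional n), IsOpen 𝒰 → lam ∈ 𝒰 →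
    Tendsto (fun l => μ l {Y | matLaw Y ∉ 𝒰}) atTop (𝓝 0)
  /-- For some `R > 0`, `limsup ‖X^{(ℓ)}‖_op ≤ R` in probability. -/
  opNorm_bound : ∃ R : ℝ, 0 < R ∧ ∀ ε : ℝ, 0 < ε →
    Tendsto (fun l => μ l {Y | R + ε ≤ Y.opNorm}) atTop (𝓝 0)
  /-- Gaussian tails, for the norm of the inner product space `M_{N_ℓ}(ℂ)_sa ^ n`. -/
  tail_bound : ∃ C K : ℝ, 0 < C ∧ 0 < K ∧ ∀ l, ∀ δ : ℝ, 0 < δ →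
    μ l {Y | C + δ ≤ ‖Y‖} ≤ ENNReal.ofReal (Real.exp (-(K * (N l : ℝ) ^ 2 * δ ^ 2)))

/-- The law `μ` on `M_N(ℂ)_sa ^ n` is invariant under simultaneous unitary conjugation. -/
def IsUnitarilyInvariant {N n : ℕ} (μ : Measure (HermTuple N n)) : Prop :=
  ∀ U : Matrix.unitaryGroup (Fin N) ℂ, μ.map (HermTuple.unitaryConj U) = μ

end Microstates

end

noncomputable section

namespace Microstates

open MeasureTheory Filter Topology Matrix
open scoped ENNReal Matrix.Norms.L2Operator

/-! ### Words and the weak-`*` topology -/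

/-! Upper bound. Let `S` be the microstate space of a neighbourhood of the law, with a cutoff
exceeding the asymptotic operator norm of the model, so that the model `μ` charges `Sᶜ` with mass
tending to zero. Gibbs' inequality bounds the entropy of `μ` by its cross entropy against a density
that is half uniform on `S` and half Gaussian off `S` (`normEntropy_le`). The part on `S` yields the
logarithmic volume of `S`. The Gaussian has variance `1/N²` in each coordinate, which makes its
normalization cancel `n log N`; the part off `S` then costs a multiple of `μ(Sᶜ)` plus the second
moment of `μ` on `Sᶜ`, and both vanish in the limit by the Gaussian tails (`lintegral_sq_norm_le`).

Attainment. For a fixed cutoff `R`, take uniform distributions on the microstate spaces of shrinking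
neighbourhoods, with sizes `N` at which the volume nearly realizes the limsup
(`exists_matrixModel_chiR_le`). Their entropy is the logarithm of the volume; they are bounded
because a matrix tuple whose moments obey the bounds of `lawSpace n R` has operator norm at most
`R`, and unitarily invariant because microstate spaces are defined through the law.

One cutoff must realize the supremum over all `R`. If the limit law lies in `lawSpace n ρ`, then `ρ
+ 2` works (`chi_eq_chiR`). A microstate `Y` with a larger cutoff and nearly correct high moments
has at most `k ≤ εN` eigenvalues beyond `ρ + 1` in each component. Cutting them off subtracts a
tuple of rank at most `k`; such tuples are parametrized by `4nkN` real parameters, so a net of `c ^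
(4nkN)` of them suffices. Subtracting a net element moves the law by `O(k/N)`, because of its rank,
and leaves norm at most `ρ + 2`. Translations preserve volume, so the loss in normalized logarithmic
volume is at most `4nε log c`, and `ε` is arbitrary. -/

theorem ncPoly_eq_sum {n : ℕ} (p : NCPoly n) : p = p.coeff.sum fun w c => c • ncWord w := by
  conv_lhs => rw [← MonoidAlgebra.sum_coeff_single p]
  refine Finsupp.sum_congr fun w _ => ?_
  simp [ncWord]

theorem NCFunctional.apply_eq_sum {n : ℕ} (lam : NCFunctional n) (p : NCPoly n) :
    lam p = ∑ w ∈ p.coeff.support, p.coeff w * lam (ncWord w) := by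
  conv_lhs => rw [ncPoly_eq_sum p]
  simp [Finsupp.sum, map_sum]

theorem continuous_apply (n : ℕ) (p : NCPoly n) : Continuous fun lam : NCFunctional n => lam p :=
  (_root_.continuous_apply p).comp continuous_induced_dom

/-- Each polynomial is a finite combination of words, so convergence on words suffices. -/
theorem topology_eq_induced_words (n : ℕ) :
    instTopologicalSpaceNCFunctional n =
      TopologicalSpace.induced (fun (lam : NCFunctional n) (w : FreeMonoid (Fin n)) =>
        lam (ncWord w)) Pi.topologicalSpace := by
  apply le_antisymm
  · rw [← continuous_iff_le_induced]
    exact continuous_pi fun w => continuous_apply n _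
  · let _ : TopologicalSpace (NCFunctional n) := TopologicalSpace.induced
      (fun (lam : NCFunctional n) (w : FreeMonoid (Fin n)) => lam (ncWord w)) Pi.topologicalSpace
    change _ ≤ TopologicalSpace.induced _ _
    rw [← continuous_iff_le_induced]
    refine continuous_pi fun p => ?_
    simp_rw [NCFunctional.apply_eq_sum _ p]
    have h : Continuous fun (lam : NCFunctional n) (w : FreeMonoid (Fin n)) => lam (ncWord w) :=
      continuous_induced_dom
    exact continuous_finsetSum _ fun w _ => continuous_const.mul (continuous_pi_iff.1 h w)

theorem continuous_of_words {n : ℕ} {T : Type*} [TopologicalSpace T] {f : T → NCFunctional n}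
    (hf : ∀ w, Continuous fun t => f t (ncWord w)) : Continuous f := by
  rw [topology_eq_induced_words, continuous_induced_rng]
  exact continuous_pi hf

/-- Functionals that agree with `lam` up to `η` on the words in `F`. -/
def wordNhd {n : ℕ} (lam : NCFunctional n) (F : Finset (FreeMonoid (Fin n))) (η : ℝ) :
    Set (NCFunctional n) :=
  {κ | ∀ w ∈ F, ‖κ (ncWord w) - lam (ncWord w)‖ < η}

theorem isOpen_wordNhd {n : ℕ} (lam : NCFunctional n) (F : Finset (FreeMonoid (Fin n))) (η : ℝ) :
    IsOpen (wordNhd lam F η) := by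
  have : wordNhd lam F η = ⋂ w ∈ F, {κ | ‖κ (ncWord w) - lam (ncWord w)‖ < η} := by
    ext κ; simp [wordNhd]
  rw [this]
  exact isOpen_biInter_finset fun w _ =>
    isOpen_lt ((continuous_apply n _).sub continuous_const).norm continuous_const

theorem mem_wordNhd_self {n : ℕ} (lam : NCFunctional n) (F : Finset (FreeMonoid (Fin n)))
    {η : ℝ} (hη : 0 < η) : lam ∈ wordNhd lam F η := fun w _ => by simpa using hη

theorem exists_wordNhd_subset {n : ℕ} {lam : NCFunctional n} {V : Set (NCFunctional n)}
    (hV : IsOpen V) (hlam : lam ∈ V) : ∃ F η, 0 < η ∧ wordNhd lam F η ⊆ V := by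
  rw [topology_eq_induced_words, isOpen_induced_iff] at hV
  obtain ⟨W, hW, rfl⟩ := hV
  obtain ⟨I, u, hu, hsub⟩ := isOpen_pi_iff.1 hW _ hlam
  have h1 : ∀ w, ∃ η > 0, w ∈ I → Metric.ball (lam (ncWord w)) η ⊆ u w := by
    intro w
    by_cases hw : w ∈ I
    · obtain ⟨η, h, h'⟩ := Metric.isOpen_iff.1 (hu w hw).1 _ (hu w hw).2
      exact ⟨η, h, fun _ => h'⟩
    · exact ⟨1, one_pos, fun h => absurd h hw⟩
  choose η hη hball using h1
  have h2 : ∃ δ > 0, ∀ w ∈ I, δ ≤ η w := by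
    classical
    induction I using Finset.induction_on with
    | empty => exact ⟨1, one_pos, by simp⟩
    | insert a s _ ih =>
      have : ∃ δ > 0, ∀ w ∈ s, δ ≤ η w := by
        clear ih hsub hu hball
        induction s using Finset.induction_on with
        | empty => exact ⟨1, one_pos, by simp⟩
        | insert b t _ ih =>
          obtain ⟨δ, hδ, h⟩ := ih (by grind)
          exact ⟨min δ (η b), lt_min hδ (hη b), by grind⟩
      obtain ⟨δ, hδ, h⟩ := this
      exact ⟨min δ (η a), lt_min hδ (hη a), by grind⟩
  obtain ⟨δ, hδ, hle⟩ := h2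
  refine ⟨I, δ, hδ, fun κ hκ => hsub fun w hw => hball w hw ?_⟩
  rw [mem_ball_iff_norm]
  exact (hκ w hw).trans_le (hle w hw)

/-- Makes microstate spaces Borel sets. -/
theorem isClosed_lawSpace (n : ℕ) (R : ℝ) : IsClosed (lawSpace n R) := by
  have h1 : IsClosed {z : ℂ | (0 : ℝ) ≤ z.re ∧ 0 = z.im} :=
    (isClosed_le continuous_const Complex.continuous_re).inter
      (isClosed_eq continuous_const Complex.continuous_im)
  have : lawSpace n R = (⋂ p : NCPoly n, {lam | lam (ncStar p * p) ∈
      {z : ℂ | (0 : ℝ) ≤ z.re ∧ 0 = z.im}}) ∩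
      ((⋂ (p : NCPoly n) (q : NCPoly n), {lam | lam (p * q) = lam (q * p)}) ∩
      ⋂ w : FreeMonoid (Fin n), {lam | ‖lam (ncWord w)‖ ≤ R ^ w.length}) := by
    ext lam
    simp [lawSpace, Complex.le_def]
  rw [this]
  refine (isClosed_iInter fun p => h1.preimage (continuous_apply n _)).inter
    ((isClosed_iInter fun p => isClosed_iInter fun q =>
      isClosed_eq (continuous_apply n _) (continuous_apply n _)).inter
    (isClosed_iInter fun w => isClosed_le (continuous_apply n _).norm continuous_const))

/-! ### Evaluation of noncommutative polynomials -/

theorem ncEval_ncWord {n : ℕ} {A : Type*} [Ring A] [Algebra ℂ A] (X : Fin n → A)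
    (w : FreeMonoid (Fin n)) : ncEval X (ncWord w) = FreeMonoid.lift X w := by
  simp [ncEval, ncWord, MonoidAlgebra.lift_single]

theorem star_lift {n : ℕ} {A : Type*} [Ring A] [StarRing A] {X : Fin n → A}
    (hX : ∀ j, IsSelfAdjoint (X j)) (w : FreeMonoid (Fin n)) :
    star (FreeMonoid.lift X w) = FreeMonoid.lift X w.reverse := by
  induction w using FreeMonoid.inductionOn' with
  | one => exact star_one A
  | of_mul i w ih => simp [FreeMonoid.reverse_mul, ih, (hX i).star_eq]

theorem ncEval_ncStar {n : ℕ} {A : Type*} [Ring A] [StarRing A] [Algebra ℂ A] [StarModule ℂ A]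
    {X : Fin n → A} (hX : ∀ j, IsSelfAdjoint (X j)) (p : NCPoly n) :
    ncEval X (ncStar p) = star (ncEval X p) := by
  conv_rhs => rw [ncPoly_eq_sum p]
  simp only [ncStar, Finsupp.sum, map_sum, star_sum, map_smul, star_smul, ncEval_ncWord,
    star_lift hX]
  refine Finset.sum_congr rfl fun w _ => ?_
  simp [ncEval, MonoidAlgebra.lift_single]

theorem ncLaw_mem_lawSpace {n : ℕ} {A : Type*} [Ring A] [StarRing A] [Algebra ℂ A]
    [StarModule ℂ A] {τ : A →ₗ[ℂ] ℂ} {X : Fin n → A} (hX : ∀ j, IsSelfAdjoint (X j))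
    (hpos : ∀ a : A, 0 ≤ (τ (star a * a)).re ∧ (τ (star a * a)).im = 0)
    (htr : ∀ a b : A, τ (a * b) = τ (b * a)) {R : ℝ}
    (hR : ∀ w, ‖τ (FreeMonoid.lift X w)‖ ≤ R ^ w.length) : ncLaw τ X ∈ lawSpace n R := by
  refine ⟨fun p => ?_, fun p q => ?_, fun w => ?_⟩
  · have := hpos (ncEval X p)
    simp [ncLaw, Complex.le_def, ncEval_ncStar hX, this]
  · simp [ncLaw, htr]
  · simpa [ncLaw, ncEval_ncWord] using hR w

/-! ### Tracial states and laws of bounded tuples -/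

namespace IsTracialState

variable {A : Type*} [Ring A] [StarRing A] [Algebra ℂ A] {τ : A →ₗ[ℂ] ℂ}

theorem re_nonneg (hτ : IsTracialState τ) (a : A) : 0 ≤ (τ (star a * a)).re :=
  (Complex.le_def.1 (hτ.positive a)).1

theorem im_eq_zero (hτ : IsTracialState τ) (a : A) : (τ (star a * a)).im = 0 :=
  (Complex.le_def.1 (hτ.positive a)).2.symm

variable [StarModule ℂ A]

/-- `τ (star b * b)` is real; `b = 1 + a` gives the imaginary part of the claim and `b = 1 + i a`
the real part. -/
theorem map_star (hτ : IsTracialState τ) (a : A) : τ (star a) = star (τ a) := by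
  have h1 := hτ.im_eq_zero (1 + a)
  have h2 := hτ.im_eq_zero (1 + Complex.I • a)
  have h3 := hτ.im_eq_zero a
  have e1 : star (1 + a) * (1 + a) = 1 + a + star a + star a * a := by
    simp only [star_add, star_one]; noncomm_ring
  have e2 : star (1 + Complex.I • a) * (1 + Complex.I • a) =
      1 + Complex.I • a - Complex.I • star a + star a * a := by
    have e3 : star (Complex.I • a) * (Complex.I • a) = star a * a := by
      rw [star_smul, smul_mul_smul_comm]; simp
    rw [star_add, star_one, add_mul, mul_add, mul_add, e3, star_smul]
    simp only [one_mul, mul_one, Complex.star_def, Complex.conj_I, neg_smul]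
    abel
  rw [e1] at h1
  rw [e2] at h2
  simp only [map_add, map_sub, hτ.unital, map_smul, Complex.add_im, Complex.sub_im, Complex.one_im,
    h3, smul_eq_mul, Complex.mul_im, Complex.I_re, Complex.I_im] at h1 h2
  apply Complex.ext
  · simp; linarith
  · simp; linarith

/-- The variance `τ (star b * b)` of `b = a - τ a • 1` is nonnegative. -/
theorem norm_sq_le (hτ : IsTracialState τ) (a : A) : ‖τ a‖ ^ 2 ≤ (τ (star a * a)).re := by
  have h := hτ.re_nonneg (a - τ a • (1 : A))
  have e : star (a - τ a • (1 : A)) * (a - τ a • (1 : A)) =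
      star a * a - star (τ a) • a - τ a • star a + (star (τ a) * τ a) • 1 := by
    simp only [star_sub, star_smul, star_one, sub_mul, mul_sub, smul_mul_assoc, mul_smul_comm,
      one_mul, mul_one, smul_sub, smul_smul]
    rw [mul_comm (τ a)]
    abel
  rw [e] at h
  simp only [map_add, map_sub, map_smul, hτ.unital, hτ.map_star, smul_eq_mul, Complex.star_def,
    Complex.add_re, Complex.sub_re, Complex.mul_re, Complex.conj_re, Complex.conj_im,
    Complex.one_re, Complex.one_im, Complex.mul_im] at h
  rw [Complex.sq_norm, Complex.normSq_apply]
  nlinarith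

theorem exists_ncLaw_mem_lawSpace (hτ : IsTracialState τ) {n : ℕ} {X : Fin n → A}
    (hX : ∀ j, IsSelfAdjoint (X j)) (hbdd : ∀ j, ∃ R : ℝ, OpNormLE τ (X j) R) :
    ∃ R > 0, ncLaw τ X ∈ lawSpace n R := by
  choose r hr using hbdd
  have hr0 : ∀ j, 0 ≤ r j := fun j => (hr j).1
  have hs : 0 ≤ ∑ j, r j := Finset.sum_nonneg fun j _ => hr0 j
  refine ⟨∑ j, r j + 1, by linarith, ncLaw_mem_lawSpace hX
    (fun a => ⟨hτ.re_nonneg a, hτ.im_eq_zero a⟩) hτ.tracial fun w => ?_⟩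
  set R := ∑ j, r j + 1
  have hR : 0 ≤ R := by simp only [R]; linarith
  -- Peel off the letters one at a time, each costing a factor `r i ≤ R` in `L²(τ)`.
  have key : ∀ w : FreeMonoid (Fin n),
      (τ (star (FreeMonoid.lift X w) * FreeMonoid.lift X w)).re ≤ (R ^ w.length) ^ 2 := by
    intro w
    induction w using FreeMonoid.inductionOn' with
    | one => simp [hτ.unital]
    | of_mul i w ih =>
      have h1 := (hr i).2 (FreeMonoid.lift X w)
      have h2 : r i ≤ R := by
        have := Finset.single_le_sum (fun j _ => hr0 j) (Finset.mem_univ i)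
        simp only [R]; linarith
      rw [map_mul (FreeMonoid.lift X), FreeMonoid.lift_eval_of, FreeMonoid.length_mul, FreeMonoid.length_of, pow_add,
        pow_one, mul_pow]
      refine h1.trans ?_
      exact mul_le_mul (pow_le_pow_left₀ (hr0 i) h2 2) ih (hτ.re_nonneg _) (by positivity)
  exact (pow_le_pow_iff_left₀ (norm_nonneg _) (by positivity) two_ne_zero).1 ((hτ.norm_sq_le _).trans (key w))

end IsTracialState

/-! ### Matrices -/

theorem norm_entry_le {k m : ℕ} (A : Matrix (Fin k) (Fin m) ℂ) (i : Fin k) (j : Fin m) :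
    ‖A i j‖ ≤ ‖A‖ := by
  have h := A.l2_opNorm_mulVec (EuclideanSpace.single j 1)
  have h1 := PiLp.norm_apply_le (p := 2)
    (WithLp.toLp 2 (A *ᵥ (EuclideanSpace.single j (1 : ℂ)).ofLp)) i
  simp only [PiLp.norm_single, norm_one, mul_one] at h
  refine le_trans ?_ (h1.trans h)
  simp

theorem norm_trace_le {k : ℕ} (A : Matrix (Fin k) (Fin k) ℂ) : ‖A.trace‖ ≤ k * ‖A‖ := by
  refine (norm_sum_le _ _).trans ?_
  refine (Finset.sum_le_sum fun i _ => norm_entry_le A i i).trans ?_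
  simp

/-- Only an inequality, since the norm is `0` when `N = 0`. -/
theorem norm_one_le_one (N : ℕ) : ‖(1 : Matrix (Fin N) (Fin N) ℂ)‖ ≤ 1 := by
  rw [← diagonal_one, l2_opNorm_diagonal]
  exact (pi_norm_le_iff_of_nonneg zero_le_one).2 fun i => by simp

theorem norm_lift_le {N n : ℕ} {Y : Fin n → Matrix (Fin N) (Fin N) ℂ} {R : ℝ}
    (hY : ∀ j, ‖Y j‖ ≤ R) (w : FreeMonoid (Fin n)) :
    ‖FreeMonoid.lift Y w‖ ≤ R ^ w.length := by
  induction w using FreeMonoid.inductionOn' with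
  | one => simpa using norm_one_le_one N
  | of_mul i w ih =>
    rw [map_mul, FreeMonoid.lift_eval_of, FreeMonoid.length_mul, FreeMonoid.length_of, pow_add,
      pow_one]
    exact (norm_mul_le _ _).trans (mul_le_mul (hY i) ih (norm_nonneg _)
      ((norm_nonneg _).trans (hY i)))

theorem normTrace_apply (N : ℕ) (A : Matrix (Fin N) (Fin N) ℂ) :
    normTrace N A = (N : ℂ)⁻¹ * A.trace := rfl

theorem matLaw_ncWord {N n : ℕ} (Y : HermTuple N n) (w : FreeMonoid (Fin n)) :
    matLaw Y (ncWord w) = (N : ℂ)⁻¹ * (FreeMonoid.lift Y.mat w).trace := by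
  simp [matLaw, ncLaw, ncEval_ncWord, normTrace_apply]

/-- The size `k` is independent of `N`: by cyclicity, the trace of a product through `ℂ^k` is that
of a `k × k` matrix, and the factor `k / N` measures the smallness of the rank. -/
theorem norm_normTrace_le {N k : ℕ} (A : Matrix (Fin k) (Fin k) ℂ) :
    ‖(N : ℂ)⁻¹ * A.trace‖ ≤ k / N * ‖A‖ := by
  rw [norm_mul, norm_inv, Complex.norm_natCast, div_eq_inv_mul, mul_assoc]
  exact mul_le_mul_of_nonneg_left (norm_trace_le A) (by positivity)

theorem normTrace_star_mul_self (N : ℕ) (A : Matrix (Fin N) (Fin N) ℂ) :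
    0 ≤ (normTrace N (star A * A)).re ∧ (normTrace N (star A * A)).im = 0 := by
  have h : (star A * A).trace = ((∑ i, ∑ j, ‖A j i‖ ^ 2 : ℝ) : ℂ) := by
    simp only [Matrix.trace, Matrix.diag_apply, Matrix.mul_apply, Matrix.star_apply,
      Complex.ofReal_sum]
    refine Finset.sum_congr rfl fun i _ => Finset.sum_congr rfl fun j _ => ?_
    rw [Complex.star_def, Complex.conj_mul']
    push_cast
    rfl
  have h2 : normTrace N (star A * A) = (((N : ℝ)⁻¹ * ∑ i, ∑ j, ‖A j i‖ ^ 2 : ℝ) : ℂ) := by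
    rw [normTrace_apply, h]; push_cast; rfl
  rw [h2]
  exact ⟨by rw [Complex.ofReal_re]; positivity, Complex.ofReal_im _⟩

/-! ### Bounds and continuity of the law of a matrix tuple -/

namespace HermTuple

variable {N n : ℕ}

theorem opNorm_le_iff (Y : HermTuple N n) {R : ℝ} (hR : 0 ≤ R) :
    Y.opNorm ≤ R ↔ ∀ j, ‖Y.mat j‖ ≤ R := by
  constructor
  · exact fun h j => (le_ciSup (f := fun j => ‖Matrix.toEuclideanCLM (𝕜 := ℂ) (Y.mat j)‖)
      (Set.finite_range _).bddAbove j).trans h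
  · exact fun h => Real.iSup_le h hR

theorem matLaw_mem_lawSpace {Y : HermTuple N n} {R : ℝ} (hR : 0 ≤ R) (hY : Y.opNorm ≤ R) :
    matLaw Y ∈ lawSpace n R := by
  refine ncLaw_mem_lawSpace (fun j => Y.mat_isHermitian j) (normTrace_star_mul_self N)
    (fun a b => by simp [normTrace_apply, Matrix.trace_mul_comm a b]) fun w => ?_
  rw [normTrace_apply]
  refine (norm_normTrace_le _).trans ?_
  refine (mul_le_of_le_one_left (norm_nonneg _) (div_self_le_one _)).trans ?_
  exact norm_lift_le ((Y.opNorm_le_iff hR).1 hY) w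

theorem continuous_mat (j : Fin n) : Continuous fun Y : HermTuple N n => Y.mat j :=
  LinearMap.continuous_of_finiteDimensional
    ({ toFun := fun Y => Y.mat j, map_add' := fun _ _ => rfl, map_smul' := fun _ _ => rfl } :
      HermTuple N n →ₗ[ℝ] Matrix (Fin N) (Fin N) ℂ)

theorem continuous_matLaw : Continuous (matLaw : HermTuple N n → NCFunctional n) := by
  refine continuous_of_words fun w => ?_
  simp_rw [matLaw_ncWord]
  refine continuous_const.mul ?_
  refine Continuous.matrix_trace ?_
  induction w using FreeMonoid.inductionOn' with
  | one => simpa using continuous_const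
  | of_mul i w ih =>
    simp only [map_mul, FreeMonoid.lift_eval_of]
    exact (continuous_mat i).matrix_mul ih

end HermTuple

/-! ### Spectral decomposition of Hermitian matrices -/

theorem norm_unitary_conj_diagonal {N : ℕ} (U : Matrix.unitaryGroup (Fin N) ℂ) (d : Fin N → ℂ) :
    ‖U.1 * diagonal d * star U.1‖ = ‖d‖ := by
  rw [CStarRing.norm_mul_mem_unitary _ (Unitary.star_mem U.2),
    CStarRing.norm_mem_unitary_mul _ U.2, l2_opNorm_diagonal]

theorem unitary_conj_pow {N : ℕ} (U : Matrix.unitaryGroup (Fin N) ℂ) (d : Fin N → ℂ) (p : ℕ) :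
    (U.1 * diagonal d * star U.1) ^ p = U.1 * diagonal (d ^ p) * star U.1 := by
  induction p with
  | zero =>
    have hU : U.1 * star U.1 = 1 := Unitary.coe_mul_star_self U
    rw [pow_zero, pow_zero, diagonal_one', mul_one, hU]
  | succ p ih =>
    have hU : star U.1 * U.1 = 1 := Unitary.coe_star_mul_self U
    have hd : diagonal (d ^ (p + 1)) = diagonal (d ^ p) * diagonal d := by
      rw [diagonal_mul_diagonal', pow_succ]; rfl
    rw [pow_succ, ih, hd]
    calc _ = U.1 * diagonal (d ^ p) * (star U.1 * U.1) * diagonal d * star U.1 := by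
          simp only [mul_assoc]
      _ = _ := by rw [hU, mul_one]; simp only [mul_assoc]

/-- A Hermitian matrix diagonalizes, with real eigenvalues. -/
theorem exists_unitary_diagonal {N : ℕ} {A : Matrix (Fin N) (Fin N) ℂ} (hA : A.IsHermitian) :
    ∃ (U : Matrix.unitaryGroup (Fin N) ℂ) (t : Fin N → ℝ),
      A = U.1 * diagonal (fun i => (t i : ℂ)) * star U.1 := by
  refine ⟨hA.eigenvectorUnitary, hA.eigenvalues, ?_⟩
  exact hA.spectral_theorem

theorem trace_pow_unitary_conj {N : ℕ} (U : Matrix.unitaryGroup (Fin N) ℂ) (t : Fin N → ℝ)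
    (p : ℕ) : ((U.1 * diagonal (fun i => (t i : ℂ)) * star U.1) ^ p).trace =
      ((∑ i, t i ^ p : ℝ) : ℂ) := by
  have hU : star U.1 * U.1 = 1 := Unitary.coe_star_mul_self U
  rw [unitary_conj_pow, Matrix.trace_mul_comm, ← mul_assoc, hU, one_mul, Matrix.trace_diagonal]
  simp

theorem lift_of_pow {n : ℕ} {A : Type*} [Monoid A] (X : Fin n → A) (j : Fin n) (p : ℕ) :
    FreeMonoid.lift X (FreeMonoid.of j ^ p) = X j ^ p := by simp

theorem length_of_pow {n : ℕ} (j : Fin n) (p : ℕ) : (FreeMonoid.of j ^ p).length = p := by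
  induction p with
  | zero => rfl
  | succ p ih => rw [pow_succ, FreeMonoid.length_mul, ih, FreeMonoid.length_of]

/-- The constant disappears in the `2m`-th root as `m → ∞`. -/
theorem abs_le_of_pow_le {t R c : ℝ} (hR : 0 < R)
    (h : ∀ m : ℕ, t ^ (2 * m) ≤ c * R ^ (2 * m)) : |t| ≤ R := by
  by_contra! hlt
  have h1 : 1 < (|t| / R) ^ 2 := one_lt_pow₀ ((one_lt_div hR).2 hlt) two_ne_zero
  obtain ⟨m, hm⟩ := pow_unbounded_of_one_lt c h1
  have h2 := h m
  rw [← pow_mul, div_pow, lt_div_iff₀ (by positivity), pow_mul |t|, sq_abs, ← pow_mul] at hm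
  linarith

/-- Each eigenvalue satisfies `t ^ (2m) ≤ N R ^ (2m)` for all `m`, by the even moments; the factor
`N` is harmless as `m → ∞`. Thus moment bounds alone force the operator norm bound. -/
theorem HermTuple.opNorm_le_of_matLaw_mem {N n : ℕ} (hN : 0 < N) {Y : HermTuple N n} {R : ℝ}
    (hR : 0 < R) (hY : matLaw Y ∈ lawSpace n R) : Y.opNorm ≤ R := by
  rw [Y.opNorm_le_iff hR.le]
  intro j
  obtain ⟨U, t, hUt⟩ := exists_unitary_diagonal (Y.mat_isHermitian j)
  rw [hUt, norm_unitary_conj_diagonal]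
  refine (pi_norm_le_iff_of_nonneg hR.le).2 fun i => ?_
  rw [Complex.norm_real, Real.norm_eq_abs]
  refine abs_le_of_pow_le (c := N) hR fun m => ?_
  have h := hY.2.2 (FreeMonoid.of j ^ (2 * m))
  rw [matLaw_ncWord, lift_of_pow, hUt, trace_pow_unitary_conj, length_of_pow, norm_mul, norm_inv,
    Complex.norm_natCast, Complex.norm_real, Real.norm_eq_abs, inv_mul_le_iff₀ (by positivity)] at h
  refine le_trans ?_ ((le_abs_self _).trans h)
  exact Finset.single_le_sum (f := fun i => t i ^ (2 * m))
    (fun i _ => Even.pow_nonneg (even_two_mul m) (t i)) (Finset.mem_univ i)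

/-! ### Differential entropy -/

section Entropy

variable {H : Type*} [NormedAddCommGroup H] [InnerProductSpace ℝ H] [FiniteDimensional ℝ H]
  [MeasurableSpace H] [BorelSpace H]

/-- Only the majorant has to be integrable, so entropy can be bounded before it is known to be
finite. -/
theorem lintegral_pos_sub_lintegral_neg_le {α : Type*} [MeasurableSpace α] {ν : Measure α}
    {f F : α → ℝ} (hfF : ∀ x, f x ≤ F x) (hF : Integrable F ν) :
    ((∫⁻ x, ENNReal.ofReal (f x) ∂ν : ℝ≥0∞) : EReal)
      - ((∫⁻ x, ENNReal.ofReal (-f x) ∂ν : ℝ≥0∞) : EReal) ≤ ((∫ x, F x ∂ν : ℝ) : EReal) := by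
  have h1 : ∫⁻ x, ENNReal.ofReal (f x) ∂ν ≤ ∫⁻ x, ENNReal.ofReal (F x) ∂ν :=
    lintegral_mono fun x => ENNReal.ofReal_le_ofReal (hfF x)
  have h2 : ∫⁻ x, ENNReal.ofReal (-F x) ∂ν ≤ ∫⁻ x, ENNReal.ofReal (-f x) ∂ν :=
    lintegral_mono fun x => ENNReal.ofReal_le_ofReal (neg_le_neg (hfF x))
  have h3 : ∫⁻ x, ENNReal.ofReal (F x) ∂ν ≠ ∞ := hF.lintegral_lt_top.ne
  have h4 : ∫⁻ x, ENNReal.ofReal (-F x) ∂ν ≠ ∞ := hF.neg.lintegral_lt_top.ne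
  refine (EReal.sub_le_sub (EReal.coe_ennreal_le_coe_ennreal_iff.2 h1)
    (EReal.coe_ennreal_le_coe_ennreal_iff.2 h2)).trans ?_
  rw [integral_eq_lintegral_pos_part_sub_lintegral_neg_part hF, EReal.coe_sub,
    ← EReal.toReal_coe_ennreal, ← EReal.toReal_coe_ennreal,
    EReal.coe_toReal (by simpa using h3) (by simp),
    EReal.coe_toReal (by simpa using h4) (by simp)]

/-- Pointwise Gibbs inequality: `log t ≤ t - 1` at `t = exp g / r`, multiplied by `r`. -/
theorem negMulLog_le {r g : ℝ} (hr : 0 ≤ r) :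
    Real.negMulLog r ≤ -(r * g) + Real.exp g - r := by
  rcases hr.eq_or_lt with rfl | hr
  · simpa using (Real.exp_pos g).le
  · have h := Real.log_le_sub_one_of_pos (div_pos (Real.exp_pos g) hr)
    rw [Real.log_div (Real.exp_pos g).ne' hr.ne', Real.log_exp] at h
    have h2 := mul_le_mul_of_nonneg_left h hr.le
    rw [mul_sub r (_ / _), mul_div_cancel₀ _ hr.ne'] at h2
    rw [Real.negMulLog]
    linarith

/-- **Gibbs' inequality**: the entropy is at most the cross entropy with respect to any
subprobability density. -/
theorem entropy_le_neg_integral {μ : Measure H} [IsProbabilityMeasure μ] {G : H → ℝ}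
    (hGm : Measurable G) (hexp : ∫⁻ x, ENNReal.ofReal (Real.exp (G x)) ≤ 1)
    (hG : Integrable G μ) : entropy μ ≤ ((-∫ x, G x ∂μ : ℝ) : EReal) := by
  rw [entropy]
  split_ifs with hac
  · set ρ : H → ℝ := fun x => (μ.rnDeriv volume x).toReal with hρ
    have i1 : Integrable ρ := Measure.integrable_toReal_rnDeriv
    have i2 : Integrable (fun x => ρ x * G x) := (integrable_rnDeriv_smul_iff hac).2 hG
    have i3 : Integrable (fun x => Real.exp (G x)) := by
      refine ⟨(Real.measurable_exp.comp hGm).aestronglyMeasurable, ?_⟩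
      rw [hasFiniteIntegral_iff_ofReal (ae_of_all _ fun x => (Real.exp_pos _).le)]
      exact hexp.trans_lt ENNReal.one_lt_top
    have i4 : Integrable (fun x => -(ρ x * G x) + Real.exp (G x) - ρ x) :=
      (i2.neg.add i3).sub i1
    refine (lintegral_pos_sub_lintegral_neg_le
      (fun x => negMulLog_le ENNReal.toReal_nonneg) i4).trans ?_
    have e0 : ∫ x, -(ρ x * G x) + Real.exp (G x) - ρ x =
        -(∫ x, ρ x * G x) + (∫ x, Real.exp (G x)) - ∫ x, ρ x := by
      have a1 : ∫ x, -(ρ x * G x) + Real.exp (G x) =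
          (∫ x, -(ρ x * G x)) + ∫ x, Real.exp (G x) := integral_add i2.neg i3
      rw [← integral_neg, ← a1]
      exact integral_sub (i2.neg.add i3) i1
    rw [EReal.coe_le_coe_iff, e0]
    have e1 : ∫ x, ρ x * G x = ∫ x, G x ∂μ := integral_rnDeriv_smul hac
    have e2 : ∫ x, ρ x = 1 := by
      rw [hρ, Measure.integral_toReal_rnDeriv hac]; simp
    have e3 : ∫ x, Real.exp (G x) ≤ 1 := by
      rw [integral_eq_lintegral_of_nonneg_ae (ae_of_all _ fun x => (Real.exp_pos _).le)
        i3.aestronglyMeasurable]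
      exact ENNReal.toReal_le_of_le_ofReal zero_le_one (by simpa using hexp)
    linarith
  · exact bot_le

theorem entropy_cond {S : Set H} (hS : MeasurableSet S) (h0 : volume S ≠ 0)
    (htop : volume S ≠ ∞) :
    entropy (ProbabilityTheory.cond volume S) = ENNReal.log (volume S) := by
  have hv : 0 < (volume S).toReal := ENNReal.toReal_pos h0 htop
  have hac : ProbabilityTheory.cond volume S ≪ volume := ProbabilityTheory.cond_absolutelyContinuous
  have hden : ProbabilityTheory.cond volume S =
      (volume : Measure H).withDensity (S.indicator fun _ => (volume S)⁻¹) := by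
    rw [withDensity_indicator hS, withDensity_const, ProbabilityTheory.cond]
  have hrn : (ProbabilityTheory.cond volume S).rnDeriv volume =ᵐ[volume]
      S.indicator fun _ => (volume S)⁻¹ := by
    rw [hden]
    exact Measure.rnDeriv_withDensity _ (measurable_const.indicator hS)
  set v := (volume S).toReal with hvdef
  have key : ∀ (φ : ℝ → ℝ), φ 0 = 0 →
      ∫⁻ x, ENNReal.ofReal (φ ((ProbabilityTheory.cond volume S).rnDeriv volume x).toReal) =
        ENNReal.ofReal (φ v⁻¹) * volume S := by
    intro φ hφ
    have : ∀ᵐ x, ENNReal.ofReal (φ ((ProbabilityTheory.cond volume S).rnDeriv volume x).toReal) =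
        S.indicator (fun _ => ENNReal.ofReal (φ v⁻¹)) x := by
      filter_upwards [hrn] with x hx
      rw [hx]
      by_cases hxS : x ∈ S
      · simp [hxS, hvdef]
      · simp [hxS, hφ]
    rw [lintegral_congr_ae this, lintegral_indicator_const hS]
  have hlog : Real.negMulLog v⁻¹ = v⁻¹ * Real.log v := by
    rw [Real.negMulLog, Real.log_inv]; ring
  have hmul : ∀ c : ℝ, ENNReal.ofReal (v⁻¹ * c) * volume S = ENNReal.ofReal c := by
    intro c
    rw [← ENNReal.ofReal_toReal htop, ← ENNReal.ofReal_mul' hv.le]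
    congr 1
    field_simp
  rw [entropy, if_pos hac, key Real.negMulLog (by simp), key (fun r => -Real.negMulLog r) (by simp),
    hlog, hmul, ← mul_neg, hmul]
  rw [ENNReal.log_pos_real h0 htop, EReal.coe_ennreal_ofReal, EReal.coe_ennreal_ofReal,
    ← EReal.coe_sub]
  congr 1
  rcases le_total 0 (Real.log v) with h | h
  · rw [max_eq_left h, max_eq_right (by linarith)]; ring
  · rw [max_eq_right h, max_eq_left (by linarith)]; ring

end Entropy

/-- Multiplication by `±i` exchanges self-adjoint and skew-adjoint matrices, so each takes half of
the real dimension `2 N ^ 2`. -/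
theorem finrank_hermTuple (N n : ℕ) : Module.finrank ℝ (HermTuple N n) = n * N ^ 2 := by
  have h0 : Module.finrank ℝ (Matrix (Fin N) (Fin N) ℂ) = 2 * N ^ 2 := by
    rw [Module.finrank_matrix]; simp; ring
  have : Module.Finite ℝ (selfAdjoint (Matrix (Fin N) (Fin N) ℂ)) :=
    FiniteDimensional.of_injective
      ({ toFun := Subtype.val, map_add' := fun _ _ => rfl, map_smul' := fun _ _ => rfl } :
        selfAdjoint (Matrix (Fin N) (Fin N) ℂ) →ₗ[ℝ] Matrix (Fin N) (Fin N) ℂ)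
      Subtype.val_injective
  have : Module.Finite ℝ (skewAdjoint (Matrix (Fin N) (Fin N) ℂ)) :=
    FiniteDimensional.of_injective
      ({ toFun := Subtype.val, map_add' := fun _ _ => rfl, map_smul' := fun _ _ => rfl } :
        skewAdjoint (Matrix (Fin N) (Fin N) ℂ) →ₗ[ℝ] Matrix (Fin N) (Fin N) ℂ)
      Subtype.val_injective
  have h1 : Module.finrank ℝ (selfAdjoint (Matrix (Fin N) (Fin N) ℂ)) =
      Module.finrank ℝ (skewAdjoint (Matrix (Fin N) (Fin N) ℂ)) := by
    refine le_antisymm ?_ ?_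
    · refine LinearMap.finrank_le_finrank_of_injective (f :=
        ({ toFun := fun a => ⟨Complex.I • a.1, by
              rw [skewAdjoint.mem_iff, star_smul, a.2.star_eq]; simp⟩
           map_add' := fun a b => Subtype.ext (smul_add Complex.I a.1 b.1)
           map_smul' := fun r a => Subtype.ext (smul_comm Complex.I r a.1) } :
          selfAdjoint (Matrix (Fin N) (Fin N) ℂ) →ₗ[ℝ] skewAdjoint (Matrix (Fin N) (Fin N) ℂ))) ?_
      intro a b h
      have h' : Complex.I • a.1 = Complex.I • b.1 := congrArg Subtype.val h
      exact Subtype.ext (smul_right_injective _ Complex.I_ne_zero h')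
    · refine LinearMap.finrank_le_finrank_of_injective (f := skewAdjoint.negISMul) ?_
      intro a b h
      have h' : -Complex.I • a.1 = -Complex.I • b.1 := congrArg Subtype.val h
      exact Subtype.ext (smul_right_injective _ (neg_ne_zero.2 Complex.I_ne_zero) h')
  have h2 := (StarModule.decomposeProdAdjoint ℝ (Matrix (Fin N) (Fin N) ℂ)).finrank_eq
  rw [Module.finrank_prod, h0, h1] at h2
  have h3 : Module.finrank ℝ (HermTuple N n) =
      Module.finrank ℝ (Fin n → selfAdjoint (Matrix (Fin N) (Fin N) ℂ)) := rfl
  rw [h3, Module.finrank_pi_fintype, Finset.sum_const, Finset.card_univ, Fintype.card_fin,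
    smul_eq_mul, h1]
  congr 1
  omega

/-! ### Microstate spaces -/

theorem lawSpace_mono {n : ℕ} {R R' : ℝ} (hR : 0 ≤ R) (h : R ≤ R') :
    lawSpace n R ⊆ lawSpace n R' := fun _ hl =>
  ⟨hl.1, hl.2.1, fun w => (hl.2.2 w).trans (pow_le_pow_left₀ hR h _)⟩

/-- The normalized logarithmic volume whose `limsup` enters the definition of `chiR`. -/
def normLogVolume {n : ℕ} {R : ℝ} (𝒰 : Set (lawSpace n R)) (N : ℕ) : EReal :=
  ((((N : ℝ) ^ 2)⁻¹ : ℝ) : EReal) *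
      ENNReal.log (volume (microstateSpace 𝒰 N : Set (HermTuple N n)))
    + ((n * Real.log N : ℝ) : EReal)

theorem chiR_eq_iInf {n : ℕ} {R : ℝ} (lam : lawSpace n R) :
    chiR lam = ⨅ (𝒰 : Set (lawSpace n R)) (_ : IsOpen 𝒰) (_ : lam ∈ 𝒰),
      limsup (normLogVolume 𝒰) atTop := rfl

theorem microstateSpace_preimage {n : ℕ} {R : ℝ} (V : Set (NCFunctional n)) (N : ℕ) :
    microstateSpace ((Subtype.val : lawSpace n R → NCFunctional n) ⁻¹' V) N =
      (matLaw : HermTuple N n → NCFunctional n) ⁻¹' lawSpace n R ∩ matLaw ⁻¹' V := by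
  ext Y; simp [microstateSpace]

theorem measurableSet_microstateSpace {n : ℕ} {R : ℝ} {𝒰 : Set (lawSpace n R)} (h𝒰 : IsOpen 𝒰)
    (N : ℕ) : MeasurableSet (microstateSpace 𝒰 N) := by
  obtain ⟨V, hV, rfl⟩ := isOpen_induced_iff.1 h𝒰
  rw [microstateSpace_preimage]
  exact ((isClosed_lawSpace n R).preimage HermTuple.continuous_matLaw).measurableSet.inter
    (hV.preimage HermTuple.continuous_matLaw).measurableSet

theorem HermTuple.norm_sq_eq {N n : ℕ} (Y : HermTuple N n) :
    ‖Y‖ ^ 2 = ∑ j, (N : ℝ)⁻¹ * (Matrix.trace (Y.mat j * Y.mat j)).re :=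
  (real_inner_self_eq_norm_sq Y).symm

/-- The words `x_j ^ 2` suffice. Hence microstate spaces have finite volume, also for `N = 0`. -/
theorem HermTuple.norm_sq_le_of_matLaw_mem {N n : ℕ} {Y : HermTuple N n} {R : ℝ}
    (hY : matLaw Y ∈ lawSpace n R) : ‖Y‖ ^ 2 ≤ n * R ^ 2 := by
  rw [Y.norm_sq_eq]
  have : ∀ j, (N : ℝ)⁻¹ * (Matrix.trace (Y.mat j * Y.mat j)).re ≤ R ^ 2 := by
    intro j
    have h := hY.2.2 (FreeMonoid.of j ^ 2)
    rw [matLaw_ncWord, lift_of_pow, length_of_pow, pow_two (Y.mat j)] at h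
    refine le_trans (le_of_eq ?_) ((Complex.re_le_norm _).trans h)
    rw [← Complex.ofReal_natCast, ← Complex.ofReal_inv, Complex.re_ofReal_mul]
  refine (Finset.sum_le_sum fun j _ => this j).trans ?_
  simp

theorem volume_microstateSpace_ne_top {n : ℕ} {R : ℝ} (𝒰 : Set (lawSpace n R)) (N : ℕ) :
    volume (microstateSpace 𝒰 N) ≠ ∞ := by
  refine (lt_of_le_of_lt (measure_mono (t := Metric.closedBall 0 (Real.sqrt (n * R ^ 2))) ?_)
    measure_closedBall_lt_top).ne
  rintro Y ⟨hY, -⟩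
  rw [mem_closedBall_zero_iff]
  exact Real.le_sqrt_of_sq_le (HermTuple.norm_sq_le_of_matLaw_mem hY)

/-! ### The entropy of a matrix model is at most the volume of its microstates -/

/-- Logarithm of the density which is uniform on `S` and Gaussian off `S`, with weight one half
each. -/
def uniformGaussianLog {N n : ℕ} (S : Set (HermTuple N n)) (Y : HermTuple N n) : ℝ :=
  S.indicator (fun _ => -Real.log 2 - Real.log (volume S).toReal) Y +
    Sᶜ.indicator (fun Y => (-Real.log 2 - n * N ^ 2 / 2 * Real.log (2 * Real.pi)
      + n * N ^ 2 * Real.log N) - N ^ 2 / 2 * ‖Y‖ ^ 2) Y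

section CrossEntropy

variable {N n : ℕ} {S : Set (HermTuple N n)}

theorem measurable_uniformGaussianLog (hS : MeasurableSet S) :
    Measurable (uniformGaussianLog S) :=
  (measurable_const.indicator hS).add
    (((measurable_const).sub (measurable_const.mul (measurable_norm.pow_const 2))).indicator
      hS.compl)

theorem lintegral_exp_uniformGaussianLog_le (hN : 0 < N) (hS : MeasurableSet S)
    (h0 : volume S ≠ 0) (htop : volume S ≠ ∞) :
    ∫⁻ Y, ENNReal.ofReal (Real.exp (uniformGaussianLog S Y)) ≤ 1 := by
  set v := (volume S).toReal with hvdef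
  have hv : 0 < v := ENNReal.toReal_pos h0 htop
  have hN' : (0 : ℝ) < N := Nat.cast_pos.2 hN
  -- Half the normalizing constant of the Gaussian with variance `1/N²` in each of the `n N²`
  -- coordinates.
  set c := Real.exp (-Real.log 2 - n * N ^ 2 / 2 * Real.log (2 * Real.pi)
      + n * N ^ 2 * Real.log N) with hc
  have hpt : ∀ Y, ENNReal.ofReal (Real.exp (uniformGaussianLog S Y)) ≤
      S.indicator (fun _ => ENNReal.ofReal (2⁻¹ * v⁻¹)) Y +
        ENNReal.ofReal (c * Real.exp (-(N ^ 2 / 2) * ‖Y‖ ^ 2)) := by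
    intro Y
    by_cases hY : Y ∈ S
    · refine le_add_right (le_of_eq ?_)
      have hY' : Y ∉ Sᶜ := fun h => h hY
      rw [uniformGaussianLog, Set.indicator_of_mem hY, Set.indicator_of_mem hY,
        Set.indicator_of_notMem hY', add_zero, sub_eq_add_neg, Real.exp_add, Real.exp_neg,
        Real.exp_neg, Real.exp_log two_pos, Real.exp_log hv]
    · refine le_add_left (le_of_eq ?_)
      rw [uniformGaussianLog, Set.indicator_of_notMem hY, Set.indicator_of_mem hY, zero_add,
        sub_eq_add_neg _ (_ * ‖Y‖ ^ 2), Real.exp_add, neg_mul]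
  refine (lintegral_mono hpt).trans ?_
  rw [lintegral_add_left (measurable_const.indicator hS), lintegral_indicator_const hS]
  have e1 : ENNReal.ofReal (2⁻¹ * v⁻¹) * volume S = ENNReal.ofReal 2⁻¹ := by
    rw [← ENNReal.ofReal_toReal htop, ← ENNReal.ofReal_mul' hv.le]
    congr 1
    field_simp
  have hb : (0 : ℝ) < N ^ 2 / 2 := by positivity
  have hg := GaussianFourier.integral_rexp_neg_mul_sq_norm (V := HermTuple N n) hb
  have hval : c * (Real.pi / (N ^ 2 / 2)) ^ ((Module.finrank ℝ (HermTuple N n) : ℝ) / 2) = 2⁻¹ := by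
    have hpi : Real.pi / ((N : ℝ) ^ 2 / 2) = 2 * Real.pi / N ^ 2 := by field_simp
    rw [finrank_hermTuple, hpi, Real.rpow_def_of_pos (by positivity), hc, ← Real.exp_add,
      Real.log_div (by positivity) (by positivity), Real.log_pow]
    rw [← Real.exp_log (show (0 : ℝ) < 2⁻¹ by positivity), Real.log_inv]
    congr 1
    push_cast
    ring
  have hint : Integrable fun Y : HermTuple N n => Real.exp (-(N ^ 2 / 2) * ‖Y‖ ^ 2) := by
    -- A non-integrable function has integral `0`, which contradicts `hval`.
    by_contra h
    rw [integral_undef h] at hg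
    rw [← hg, mul_zero] at hval
    norm_num at hval
  have e2 : ∫⁻ Y : HermTuple N n, ENNReal.ofReal (c * Real.exp (-(N ^ 2 / 2) * ‖Y‖ ^ 2)) =
      ENNReal.ofReal 2⁻¹ := by
    rw [← ofReal_integral_eq_lintegral_ofReal (hint.const_mul c)
      (ae_of_all _ fun Y => by positivity), integral_const_mul, hg, hval]
  rw [e1, e2, ← ENNReal.ofReal_add (by norm_num) (by norm_num)]
  norm_num

variable {μ : Measure (HermTuple N n)} [IsProbabilityMeasure μ]

theorem integrable_uniformGaussianLog (hS : MeasurableSet S)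
    (h2 : Integrable (fun Y => ‖Y‖ ^ 2) μ) : Integrable (uniformGaussianLog S) μ :=
  ((integrable_const _).indicator hS).add
    (((integrable_const _).sub (h2.const_mul _)).indicator hS.compl)

theorem integral_uniformGaussianLog (hS : MeasurableSet S)
    (h2 : Integrable (fun Y => ‖Y‖ ^ 2) μ) :
    ∫ Y, uniformGaussianLog S Y ∂μ = μ.real S * (-Real.log 2 - Real.log (volume S).toReal) +
      ((1 - μ.real S) * (-Real.log 2 - n * N ^ 2 / 2 * Real.log (2 * Real.pi)
      + n * N ^ 2 * Real.log N) - N ^ 2 / 2 * ∫ Y in Sᶜ, ‖Y‖ ^ 2 ∂μ) := by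
  have hi : Integrable (fun Y => (-Real.log 2 - n * N ^ 2 / 2 * Real.log (2 * Real.pi)
      + n * N ^ 2 * Real.log N) - N ^ 2 / 2 * ‖Y‖ ^ 2) μ :=
    (integrable_const _).sub (h2.const_mul _)
  unfold uniformGaussianLog
  rw [integral_add ((integrable_const _).indicator hS) (hi.indicator hS.compl),
    integral_indicator hS, integral_indicator hS.compl, integral_sub (integrable_const _) (h2.const_mul _).integrableOn,
    setIntegral_const, setIntegral_const, integral_const_mul, probReal_compl_eq_one_sub hS,
    smul_eq_mul, smul_eq_mul]

/-- Gibbs' inequality against the mixed density. Off `S` the Gaussian normalization `n N² log N`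
cancels the term `n log N` of the normalized entropy, so the contribution there stays bounded in `N`
when weighted by the mass and second moment of `Sᶜ`. -/
theorem normEntropy_le (hN : 0 < N) (hS : MeasurableSet S) (h0 : volume S ≠ 0)
    (htop : volume S ≠ ∞) (h2 : Integrable (fun Y => ‖Y‖ ^ 2) μ) :
    normEntropy μ ≤ ((μ.real S * (((N : ℝ) ^ 2)⁻¹ * Real.log (volume S).toReal + n * Real.log N)
      + (((N : ℝ) ^ 2)⁻¹ * Real.log 2 + (1 - μ.real S) * (n / 2 * Real.log (2 * Real.pi))
        + 1 / 2 * ∫ Y in Sᶜ, ‖Y‖ ^ 2 ∂μ) : ℝ) : EReal) := by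
  have hN' : (N : ℝ) ≠ 0 := Nat.cast_ne_zero.2 hN.ne'
  have h := entropy_le_neg_integral (measurable_uniformGaussianLog hS)
    (lintegral_exp_uniformGaussianLog_le hN hS h0 htop) (integrable_uniformGaussianLog hS h2)
  rw [integral_uniformGaussianLog hS h2] at h
  rw [normEntropy]
  refine (add_le_add_left (mul_le_mul_of_nonneg_left h
    (EReal.coe_nonneg.2 (by positivity))) _).trans (le_of_eq ?_)
  rw [← EReal.coe_mul, ← EReal.coe_add]
  congr 1
  field_simp
  ring

end CrossEntropy

/-! ### Gaussian tails and second moments -/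

theorem summable_shells (C : ℝ) {K : ℝ} (hK : 0 < K) :
    Summable fun k : ℕ => Real.exp (-K * k) * (C + k + 2) ^ 2 := by
  have h (i : ℕ) := Real.summable_pow_mul_exp_neg_nat_mul i hK
  refine (((h 2).add ((h 1).mul_left (2 * (C + 2)))).add ((h 0).mul_left ((C + 2) ^ 2))).congr
    fun k => ?_
  ring_nf

/-- Beyond `C + 1`, the unit shell that contains `r` gives a sufficient term of the sum. -/
theorem sq_le_add_tsum_shells {C r : ℝ} (hr : 0 ≤ r) :
    ENNReal.ofReal (r ^ 2) ≤ ENNReal.ofReal ((C + 1) ^ 2) +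
      ∑' k : ℕ, (Set.Ici (C + (k + 1 : ℝ))).indicator
        (fun _ => ENNReal.ofReal ((C + k + 2) ^ 2)) r := by
  rcases le_total r (C + 1) with h | h
  · exact le_add_right (ENNReal.ofReal_le_ofReal (pow_le_pow_left₀ hr h 2))
  · refine le_add_left (le_trans ?_ (ENNReal.le_tsum ⌊r - (C + 1)⌋₊))
    have h1 := Nat.floor_le (sub_nonneg.2 h)
    have h2 := Nat.lt_floor_add_one (r - (C + 1))
    rw [Set.indicator_of_mem (Set.mem_Ici.2 (by linarith))]
    exact ENNReal.ofReal_le_ofReal (pow_le_pow_left₀ hr (by linarith) 2)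

/-- Within radius `C + 1` the integrand is bounded; outside, unit shells are controlled by the tails
at `δ = k + 1`. The second term does not depend on `T` and vanishes as `N → ∞`. -/
theorem lintegral_sq_norm_le {N n : ℕ} (hN : 0 < N) {μ : Measure (HermTuple N n)} {C K : ℝ}
    (hC : 0 < C) (hK : 0 < K) (htail : ∀ δ : ℝ, 0 < δ →
      μ {Y | C + δ ≤ ‖Y‖} ≤ ENNReal.ofReal (Real.exp (-(K * (N : ℝ) ^ 2 * δ ^ 2))))
    (T : Set (HermTuple N n)) :
    ∫⁻ Y in T, ENNReal.ofReal (‖Y‖ ^ 2) ∂μ ≤ ENNReal.ofReal ((C + 1) ^ 2) * μ T +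
      ENNReal.ofReal (Real.exp (-(K * (N : ℝ) ^ 2)) *
        ∑' k : ℕ, Real.exp (-K * k) * (C + k + 2) ^ 2) := by
  have hmeas : ∀ k : ℕ, MeasurableSet {Y : HermTuple N n | C + (k + 1 : ℝ) ≤ ‖Y‖} := fun k =>
    measurableSet_le measurable_const measurable_norm
  have hterm : ∀ k : ℕ, ∫⁻ Y in T, (Set.Ici (C + (k + 1 : ℝ))).indicator
      (fun _ => ENNReal.ofReal ((C + k + 2) ^ 2)) ‖Y‖ ∂μ ≤
      ENNReal.ofReal (Real.exp (-(K * (N : ℝ) ^ 2)) *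
        (Real.exp (-K * k) * (C + k + 2) ^ 2)) := by
    intro k
    have e : (fun Y : HermTuple N n => (Set.Ici (C + (k + 1 : ℝ))).indicator
        (fun _ => ENNReal.ofReal ((C + k + 2) ^ 2)) ‖Y‖) =
        {Y : HermTuple N n | C + (k + 1 : ℝ) ≤ ‖Y‖}.indicator
          (fun _ => ENNReal.ofReal ((C + k + 2) ^ 2)) := by
      ext Y; rfl
    refine (setLIntegral_le_lintegral T _).trans ?_
    rw [e, lintegral_indicator_const (hmeas k)]
    refine (mul_le_mul_right (htail (k + 1) (by positivity)) _).trans ?_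
    rw [← ENNReal.ofReal_mul (by positivity), ← mul_assoc, ← Real.exp_add, mul_comm]
    refine ENNReal.ofReal_le_ofReal (mul_le_mul_of_nonneg_right ?_ (by positivity))
    refine Real.exp_le_exp.2 ?_
    have h1 : (1 : ℝ) ≤ N := by exact_mod_cast hN
    have h2 : (1 : ℝ) ≤ (N : ℝ) ^ 2 := one_le_pow₀ h1
    have h3 : (0 : ℝ) ≤ k := Nat.cast_nonneg k
    -- Splits off the factor `exp (-K N²)` and keeps `exp (-K k)` for summability over shells.
    have h4 : (N : ℝ) ^ 2 + k ≤ (N : ℝ) ^ 2 * (k + 1) ^ 2 := by nlinarith [sq_nonneg (k : ℝ)]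
    nlinarith
  have hsum := summable_shells C hK
  calc ∫⁻ Y in T, ENNReal.ofReal (‖Y‖ ^ 2) ∂μ
      ≤ ∫⁻ Y in T, (ENNReal.ofReal ((C + 1) ^ 2) + ∑' k : ℕ, (Set.Ici (C + (k + 1 : ℝ))).indicator
        (fun _ => ENNReal.ofReal ((C + k + 2) ^ 2)) ‖Y‖) ∂μ :=
        lintegral_mono fun Y => sq_le_add_tsum_shells (norm_nonneg Y)
    _ = ENNReal.ofReal ((C + 1) ^ 2) * μ T + ∑' k : ℕ, ∫⁻ Y in T,
        (Set.Ici (C + (k + 1 : ℝ))).indicator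
          (fun _ => ENNReal.ofReal ((C + k + 2) ^ 2)) ‖Y‖ ∂μ := by
        rw [lintegral_add_left measurable_const, setLIntegral_const, lintegral_tsum]
        exact fun k => ((measurable_const.indicator measurableSet_Ici).comp
          measurable_norm).aemeasurable
    _ ≤ _ := by
        refine add_le_add_right ((ENNReal.tsum_le_tsum hterm).trans (le_of_eq ?_)) _
        rw [← tsum_mul_left, ENNReal.ofReal_tsum_of_nonneg (fun k => by positivity)
          (hsum.mul_left _)]

/-- The microstates upper bound for the entropy of a matrix model. -/
theorem IsMatrixModel.limsup_normEntropy_le_chi {n : ℕ} {lam : NCFunctional n}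
    (hlam : ∃ R > 0, lam ∈ lawSpace n R) {N : ℕ → ℕ} {μ : (l : ℕ) → Measure (HermTuple (N l) n)}
    (hμ : IsMatrixModel lam N μ) :
    limsup (fun l => normEntropy (μ l)) atTop ≤ chi lam := by
  obtain ⟨R₀, hR₀, hlam⟩ := hlam
  obtain ⟨R₁, hR₁, hop⟩ := hμ.opNorm_bound
  obtain ⟨C, K, hC, hK, htail⟩ := hμ.tail_bound
  have hprob := hμ.isProb
  -- The extra `1` lets the operator norm bound hold with probability tending to one at this cutoff.
  set R := max R₀ (R₁ + 1) with hRdef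
  have hR : 0 < R := lt_max_of_lt_left hR₀
  have hlamR : lam ∈ lawSpace n R := lawSpace_mono hR₀.le (le_max_left _ _) hlam
  refine le_trans ?_ (le_iSup_of_le R (le_iSup_of_le hR (le_iSup (fun h => chiR ⟨lam, h⟩) hlamR)))
  rw [chiR_eq_iInf]
  refine le_iInf fun 𝒰 => le_iInf fun h𝒰 => le_iInf fun hmem => ?_
  have hS := fun l => measurableSet_microstateSpace h𝒰 (N l)
  set S : (l : ℕ) → Set (HermTuple (N l) n) := fun l => microstateSpace 𝒰 (N l) with hSdef
  have hcompl : Tendsto (fun l => μ l (S l)ᶜ) atTop (𝓝 0) := by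
    obtain ⟨V, hV, rfl⟩ := isOpen_induced_iff.1 h𝒰
    have hsum := (hμ.tendsto_law V hV hmem).add (hop 1 one_pos)
    rw [add_zero] at hsum
    refine tendsto_of_tendsto_of_tendsto_of_le_of_le tendsto_const_nhds hsum
      (fun l => zero_le) fun l => (measure_mono ?_).trans (measure_union_le _ _)
    intro Y hY
    by_contra hcon
    simp only [Set.mem_union, Set.mem_ofPred_eq, not_or, not_not, not_le] at hcon
    refine hY ?_
    rw [hSdef]
    simp only [microstateSpace_preimage]
    exact ⟨HermTuple.matLaw_mem_lawSpace hR.le (hcon.2.le.trans (le_max_right _ _)), hcon.1⟩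
  set A := ∑' k : ℕ, Real.exp (-K * k) * (C + k + 2) ^ 2 with hA
  have hA0 : 0 ≤ A := tsum_nonneg fun k => by positivity
  have hlin := fun l T => lintegral_sq_norm_le (hμ.size_pos l) hC hK (htail l) T
  have h2 : ∀ l, Integrable (fun Y => ‖Y‖ ^ 2) (μ l) := by
    intro l
    refine ⟨(measurable_norm.pow_const 2).aestronglyMeasurable, ?_⟩
    rw [hasFiniteIntegral_iff_ofReal (ae_of_all _ fun Y => by positivity)]
    have := hlin l Set.univ
    rw [Measure.restrict_univ, measure_univ, mul_one] at this
    exact this.trans_lt (ENNReal.add_lt_top.2 ⟨ENNReal.ofReal_lt_top, ENNReal.ofReal_lt_top⟩)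
  have hq : Tendsto (fun l => (μ l).real (S l)ᶜ) atTop (𝓝 0) := by
    have h := (ENNReal.tendsto_toReal ENNReal.zero_ne_top).comp hcompl
    rwa [ENNReal.toReal_zero] at h
  have hp : ∀ l, (μ l).real (S l)ᶜ = 1 - (μ l).real (S l) := fun l =>
    probReal_compl_eq_one_sub (hS l)
  have hset : ∀ l, ∫ Y in (S l)ᶜ, ‖Y‖ ^ 2 ∂(μ l) ≤
      (C + 1) ^ 2 * (μ l).real (S l)ᶜ + Real.exp (-(K * (N l : ℝ) ^ 2)) * A := by
    intro l
    rw [integral_eq_lintegral_of_nonneg_ae (ae_of_all _ fun Y => by positivity)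
      (h2 l).integrableOn.aestronglyMeasurable]
    refine ENNReal.toReal_le_of_le_ofReal (by positivity) ((hlin l _).trans (le_of_eq ?_))
    rw [ENNReal.ofReal_add (by positivity) (by positivity),
      ENNReal.ofReal_mul (p := (C + 1) ^ 2) (by positivity), measureReal_def,
      ENNReal.ofReal_toReal (measure_ne_top _ _)]
  have hNR : Tendsto (fun l => (N l : ℝ)) atTop atTop :=
    tendsto_natCast_atTop_atTop.comp hμ.size_tendsto
  have hN2 : Tendsto (fun l => (N l : ℝ) ^ 2) atTop atTop :=
    (tendsto_pow_atTop two_ne_zero).comp hNR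
  have hexp : Tendsto (fun l => Real.exp (-(K * (N l : ℝ) ^ 2))) atTop (𝓝 0) :=
    Real.tendsto_exp_neg_atTop_nhds_zero.comp (hN2.const_mul_atTop hK)
  rw [← EReal.le_of_forall_lt_iff_le]
  intro c hc
  have hev : ∀ᶠ l in atTop, normLogVolume 𝒰 (N l) < c :=
    hμ.size_tendsto.eventually (eventually_lt_of_limsup_lt hc)
  have hpos : ∀ᶠ l in atTop, (μ l).real (S l)ᶜ < 1 := hq.eventually (gt_mem_nhds one_pos)
  -- The upper bound of `normEntropy_le` with the logarithmic volume replaced by `c`; it converges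
  -- to `c`.
  set b : ℕ → ℝ := fun l => (1 - (μ l).real (S l)ᶜ) * c
      + (((N l : ℝ) ^ 2)⁻¹ * Real.log 2 + (μ l).real (S l)ᶜ * (n / 2 * Real.log (2 * Real.pi))
        + 1 / 2 * ((C + 1) ^ 2 * (μ l).real (S l)ᶜ + Real.exp (-(K * (N l : ℝ) ^ 2)) * A)) with hb
  have hbt : Tendsto b atTop (𝓝 c) := by
    have := ((hq.const_sub 1).mul_const c).add
      ((((tendsto_inv_atTop_zero.comp hN2).mul_const (Real.log 2)).add
        (hq.mul_const (n / 2 * Real.log (2 * Real.pi)))).add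
        (((hq.const_mul ((C + 1) ^ 2)).add (hexp.mul_const A)).const_mul (1 / 2)))
    simpa [hb] using this
  have hbt' : Tendsto (fun l => (b l : EReal)) atTop (𝓝 (c : EReal)) :=
    (continuous_coe_real_ereal.tendsto c).comp hbt
  rw [← hbt'.limsup_eq]
  refine limsup_le_limsup ?_
  filter_upwards [hev, hpos] with l hl hl1
  have hN0 : (0 : ℝ) < N l := Nat.cast_pos.2 (hμ.size_pos l)
  -- A null microstate space of positive `μ l`-mass excludes a density, so the entropy is `⊥`.
  by_cases h0 : volume (S l) = 0
  · have hent : entropy (μ l) = ⊥ := by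
      rw [entropy, if_neg]
      intro hac
      rw [hp, measureReal_def, hac h0] at hl1
      simp at hl1
    rw [normEntropy, hent, EReal.coe_mul_bot_of_pos (by positivity), EReal.bot_add]
    exact bot_le
  · have htop : volume (S l) ≠ ∞ := volume_microstateSpace_ne_top 𝒰 (N l)
    refine (normEntropy_le (hμ.size_pos l) (hS l) h0 htop (h2 l)).trans ?_
    have hlog : normLogVolume 𝒰 (N l) =
        ((((N l : ℝ) ^ 2)⁻¹ * Real.log (volume (S l)).toReal + n * Real.log (N l) : ℝ) : EReal) := by
      rw [normLogVolume, ENNReal.log_pos_real h0 htop, ← EReal.coe_mul, ← EReal.coe_add]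
    rw [hlog, EReal.coe_lt_coe_iff] at hl
    rw [EReal.coe_le_coe_iff, hb]
    simp only [hp] at hset ⊢
    have h1 : (0 : ℝ) ≤ (μ l).real (S l) := measureReal_nonneg
    have h3 := mul_le_mul_of_nonneg_left hl.le h1
    have h4 := hset l
    linarith

/-! ### Nets in finite-dimensional spaces -/

/-- Packing: the disjoint balls of radius `δ / 2` about the points lie in the ball of radius `M + δ
/ 2`; compare volumes. -/
theorem card_le_of_norm_le_of_separated {E : Type*} [NormedAddCommGroup E] [NormedSpace ℝ E]
    [FiniteDimensional ℝ E] (s : Finset E) {M δ : ℝ} (hM : 0 ≤ M) (hδ : 0 < δ)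
    (hs : ∀ c ∈ s, ‖c‖ ≤ M) (h : ∀ c ∈ s, ∀ d ∈ s, c ≠ d → δ ≤ ‖c - d‖) :
    (s.card : ℝ) ≤ (1 + 2 * M / δ) ^ Module.finrank ℝ E := by
  borelize E
  let μ : Measure E := Measure.addHaar
  have hδ2 : 0 < δ / 2 := half_pos hδ
  have hr : 0 < M + δ / 2 := by linarith
  have hdisj : Set.Pairwise (s : Set E)
      (Function.onFun Disjoint fun c => Metric.ball (c : E) (δ / 2)) := by
    intro c hc d hd hcd
    apply Metric.ball_disjoint_ball
    rw [dist_eq_norm, add_halves]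
    exact h c hc d hd hcd
  have hsub : (⋃ c ∈ s, Metric.ball (c : E) (δ / 2)) ⊆ Metric.ball (0 : E) (M + δ / 2) := by
    refine Set.iUnion₂_subset fun x hx => Metric.ball_subset_ball' ?_
    rw [dist_zero_right]
    linarith [hs x hx]
  have hI := measure_mono (μ := μ) hsub
  rw [measure_biUnion_finset hdisj fun c _ => measurableSet_ball, μ.addHaar_ball_of_pos _ hr] at hI
  simp only [μ.addHaar_ball_of_pos _ hδ2, Finset.sum_const, nsmul_eq_mul, ← mul_assoc] at hI
  have hJ := (ENNReal.mul_le_mul_iff_left (Metric.measure_ball_pos μ (0 : E) zero_lt_one).ne'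
    measure_ball_lt_top.ne).1 hI
  have hK := ENNReal.toReal_le_of_le_ofReal (by positivity) hJ
  rw [ENNReal.toReal_mul, ENNReal.toReal_natCast, ENNReal.toReal_ofReal (by positivity),
    ← le_div_iff₀ (by positivity), ← div_pow] at hK
  refine hK.trans (le_of_eq ?_)
  congr 1
  field_simp
  ring

/-- A `δ`-separated subset of `T` of maximal cardinality is a net. Its points lie in `T` itself, so
they keep the defining property of `T`. -/
theorem exists_finite_net {E : Type*} [NormedAddCommGroup E] [NormedSpace ℝ E]
    [FiniteDimensional ℝ E] {T : Set E} {M δ : ℝ} (hM : 0 ≤ M) (hδ : 0 < δ)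
    (hT : ∀ c ∈ T, ‖c‖ ≤ M) :
    ∃ s : Finset E, ↑s ⊆ T ∧ (s.card : ℝ) ≤ (1 + 2 * M / δ) ^ Module.finrank ℝ E ∧
      ∀ c ∈ T, ∃ d ∈ s, ‖c - d‖ < δ := by
  classical
  set P : Finset E → Prop := fun s => ↑s ⊆ T ∧ ∀ c ∈ s, ∀ d ∈ s, c ≠ d → δ ≤ ‖c - d‖ with hP
  have hcard : ∀ s, P s → (s.card : ℝ) ≤ (1 + 2 * M / δ) ^ Module.finrank ℝ E := fun s hs =>
    card_le_of_norm_le_of_separated s hM hδ (fun c hc => hT c (hs.1 hc)) hs.2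
  set J : Set ℕ := {m | ∃ s, P s ∧ s.card = m} with hJ
  have hne : J.Nonempty := ⟨0, ∅, by simp [hP], rfl⟩
  have hbdd : BddAbove J := by
    refine ⟨⌊(1 + 2 * M / δ) ^ Module.finrank ℝ E⌋₊, ?_⟩
    rintro m ⟨s, hs, rfl⟩
    exact Nat.le_floor (hcard s hs)
  obtain ⟨s, hs, hsJ⟩ := Nat.sSup_mem hne hbdd
  refine ⟨s, hs.1, hcard s hs, fun c hc => ?_⟩
  by_contra! hcon
  have hcs : c ∉ s := fun hmem => by
    have := hcon c hmem
    rw [sub_self, norm_zero] at this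
    linarith
  have hins : P (insert c s) := by
    refine ⟨by rw [Finset.coe_insert]; exact Set.insert_subset hc hs.1, fun a ha b hb hab => ?_⟩
    rcases Finset.mem_insert.1 ha with ha' | ha'
    · rcases Finset.mem_insert.1 hb with hb' | hb'
      · exact absurd (ha'.trans hb'.symm) hab
      · rw [ha']; exact hcon b hb'
    · rcases Finset.mem_insert.1 hb with hb' | hb'
      · rw [hb', norm_sub_rev]; exact hcon a ha'
      · exact hs.2 a ha' b hb' hab
  have := le_csSup hbdd ⟨_, hins, rfl⟩
  rw [Finset.card_insert_of_notMem hcs, hsJ] at this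
  omega

/-! ### Tuples of matrices of small rank -/

/-- `Z` factors, in each component, through `ℂ^k` with factors of norm at most `M`. -/
def FactorsThrough {N n : ℕ} (k : ℕ) (M : ℝ) (Z : HermTuple N n) : Prop :=
  ∃ (A : Fin n → Matrix (Fin N) (Fin k) ℂ) (B : Fin n → Matrix (Fin k) (Fin N) ℂ),
    ∀ j, ‖A j‖ ≤ M ∧ ‖B j‖ ≤ M ∧ Z.mat j = A j * B j

theorem finrank_factor_pairs (N n k : ℕ) : Module.finrank ℝ
    (Fin n → Matrix (Fin N) (Fin k) ℂ × Matrix (Fin k) (Fin N) ℂ) = 4 * n * k * N := by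
  rw [Module.finrank_pi_fintype]
  simp only [Module.finrank_prod, Module.finrank_matrix, Complex.finrank_real_complex,
    Fintype.card_fin, Finset.sum_const, Finset.card_univ, smul_eq_mul]
  ring

/-- The net is taken among the factors, whose space has dimension `4nkN` instead of order `N²`. Its
mesh in operator norm is only `1`; what matters is that its elements again have small rank. -/
theorem exists_finite_net_factorsThrough (N n k : ℕ) {M : ℝ} (hM : 0 < M) :
    ∃ F : Finset (HermTuple N n), (∀ Z ∈ F, FactorsThrough k M Z) ∧
      (F.card : ℝ) ≤ (1 + 4 * M ^ 2) ^ (4 * n * k * N) ∧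
      ∀ Z, FactorsThrough k M Z → ∃ Z' ∈ F, ∀ j, ‖Z.mat j - Z'.mat j‖ ≤ 1 := by
  classical
  set E := Fin n → Matrix (Fin N) (Fin k) ℂ × Matrix (Fin k) (Fin N) ℂ
  set T : Set E := {P | ∃ Z : HermTuple N n,
    ∀ j, ‖(P j).1‖ ≤ M ∧ ‖(P j).2‖ ≤ M ∧ Z.mat j = (P j).1 * (P j).2} with hTdef
  have hT : ∀ P ∈ T, ‖P‖ ≤ M := by
    rintro P ⟨Z, hZ⟩
    exact (pi_norm_le_iff_of_nonneg hM.le).2 fun j => max_le (hZ j).1 (hZ j).2.1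
  have hfd : FiniteDimensional ℝ E := inferInstanceAs (FiniteDimensional ℝ
    (Fin n → Matrix (Fin N) (Fin k) ℂ × Matrix (Fin k) (Fin N) ℂ))
  -- On the ball of radius `M`, errors `1 / (2M)` in both factors change the product by at most `1`.
  obtain ⟨s, hsT, hcard, hnet⟩ := exists_finite_net hM.le (δ := 1 / (2 * M)) (by positivity) hT
  have hex : ∀ P : E, ∃ Z : HermTuple N n, P ∈ T →
      ∀ j, ‖(P j).1‖ ≤ M ∧ ‖(P j).2‖ ≤ M ∧ Z.mat j = (P j).1 * (P j).2 := by
    intro P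
    by_cases hP : P ∈ T
    · exact ⟨hP.choose, fun _ => hP.choose_spec⟩
    · exact ⟨0, fun h => absurd h hP⟩
  choose φ hφ using hex
  refine ⟨s.image φ, ?_, ?_, ?_⟩
  · intro Z hZ
    obtain ⟨P, hP, rfl⟩ := Finset.mem_image.1 hZ
    exact ⟨fun j => (P j).1, fun j => (P j).2, hφ P (hsT hP)⟩
  · refine (Nat.cast_le.2 Finset.card_image_le).trans (hcard.trans (le_of_eq ?_))
    have : Module.finrank ℝ E = 4 * n * k * N := finrank_factor_pairs N n k
    rw [this]
    congr 1
    field_simp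
    ring
  · rintro Z ⟨A, B, hAB⟩
    have hQ : (fun j => (A j, B j) : E) ∈ T := ⟨Z, hAB⟩
    obtain ⟨P, hP, hdist⟩ := hnet _ hQ
    refine ⟨φ P, Finset.mem_image_of_mem φ hP, fun j => ?_⟩
    have hPj := hφ P (hsT hP) j
    have hd := (norm_le_pi_norm ((fun j => (A j, B j) : E) - P) j).trans hdist.le
    have hd1 : ‖A j - (P j).1‖ ≤ 1 / (2 * M) := (le_max_left _ _).trans hd
    have hd2 : ‖B j - (P j).2‖ ≤ 1 / (2 * M) := (le_max_right _ _).trans hd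
    rw [(hAB j).2.2, hPj.2.2]
    have e : A j * B j - (P j).1 * (P j).2 =
        A j * (B j - (P j).2) + (A j - (P j).1) * (P j).2 := by
      rw [Matrix.mul_sub, Matrix.sub_mul]; abel
    rw [e]
    refine (norm_add_le _ _).trans ?_
    have h1 := (Matrix.l2_opNorm_mul (A j) (B j - (P j).2)).trans
      (mul_le_mul (hAB j).1 hd2 (norm_nonneg _) hM.le)
    have h2 := (Matrix.l2_opNorm_mul (A j - (P j).1) (P j).2).trans
      (mul_le_mul hd1 hPj.2.1 (norm_nonneg _) (by positivity))
    have h3 : M * (1 / (2 * M)) + 1 / (2 * M) * M = 1 := by field_simp; norm_num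
    linarith

/-- Exchange the letters one by one. Each difference contains some `A i * B i`, and cyclicity turns
its trace into that of a `k × k` matrix. The prefix `P` collects letters already exchanged.
Smallness comes from rank, not from the norm of `Y - W`. -/
theorem norm_trace_lift_sub_le {N n k : ℕ} {Y W : Fin n → Matrix (Fin N) (Fin N) ℂ}
    {A : Fin n → Matrix (Fin N) (Fin k) ℂ} {B : Fin n → Matrix (Fin k) (Fin N) ℂ} {L : ℝ}
    (hY : ∀ j, ‖Y j‖ ≤ L) (hW : ∀ j, ‖W j‖ ≤ L) (hA : ∀ j, ‖A j‖ ≤ L) (hB : ∀ j, ‖B j‖ ≤ L)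
    (hYW : ∀ j, Y j - W j = A j * B j) (w : FreeMonoid (Fin n)) (P : Matrix (Fin N) (Fin N) ℂ) :
    ‖(N : ℂ)⁻¹ * (P * (FreeMonoid.lift Y w - FreeMonoid.lift W w)).trace‖ ≤
      k / N * (‖P‖ * (w.length * L ^ (w.length + 1))) := by
  induction w using FreeMonoid.inductionOn' generalizing P with
  | one => simp
  | of_mul i w ih =>
    have hL : 0 ≤ L := (norm_nonneg _).trans (hY i)
    have e : P * (FreeMonoid.lift Y (FreeMonoid.of i * w) -
        FreeMonoid.lift W (FreeMonoid.of i * w)) =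
        P * A i * (B i * FreeMonoid.lift Y w) +
          (P * W i) * (FreeMonoid.lift Y w - FreeMonoid.lift W w) := by
      have : Y i = A i * B i + W i := by rw [← hYW]; abel
      rw [map_mul, map_mul, FreeMonoid.lift_eval_of, FreeMonoid.lift_eval_of, this]
      simp only [Matrix.add_mul, Matrix.mul_sub, Matrix.mul_add, Matrix.mul_assoc]
      abel
    rw [e, Matrix.trace_add, mul_add, Matrix.trace_mul_comm]
    refine (norm_add_le _ _).trans ?_
    have h1 : ‖B i * FreeMonoid.lift Y w * (P * A i)‖ ≤ L * L ^ w.length * (‖P‖ * L) := by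
      refine (Matrix.l2_opNorm_mul _ _).trans (mul_le_mul ?_ ?_ (norm_nonneg _) (by positivity))
      · exact (Matrix.l2_opNorm_mul _ _).trans
          (mul_le_mul (hB i) (norm_lift_le hY w) (norm_nonneg _) hL)
      · exact (Matrix.l2_opNorm_mul _ _).trans (mul_le_mul_of_nonneg_left (hA i) (norm_nonneg _))
    have h2 : ‖P * W i‖ ≤ ‖P‖ * L :=
      (norm_mul_le _ _).trans (mul_le_mul_of_nonneg_left (hW i) (norm_nonneg _))
    have h3 := (norm_normTrace_le (N := N) (B i * FreeMonoid.lift Y w * (P * A i))).trans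
      (mul_le_mul_of_nonneg_left h1 (by positivity))
    have h4 := (ih (P * W i)).trans (mul_le_mul_of_nonneg_left
      (mul_le_mul_of_nonneg_right h2 (by positivity)) (by positivity))
    refine (add_le_add h3 h4).trans (le_of_eq ?_)
    rw [FreeMonoid.length_mul, FreeMonoid.length_of]
    push_cast
    ring

/-! ### Truncation of the spectrum -/

/-- `P` is the 0–1 matrix of an injection of `I` into `Fin k`; it factors the coordinate projection
onto `I` through `ℂ^k`. -/
theorem exists_partial_isometry {N k : ℕ} (I : Finset (Fin N)) (hI : I.card ≤ k) :
    ∃ P : Matrix (Fin N) (Fin k) ℂ, ‖P‖ ≤ 1 ∧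
      P * Pᴴ = diagonal fun i => if i ∈ I then 1 else 0 := by
  obtain ⟨e⟩ := Function.Embedding.nonempty_of_card_le (α := I) (β := Fin k) (by simpa using hI)
  let P : Matrix (Fin N) (Fin k) ℂ :=
    Matrix.of fun i c => if ∃ h : i ∈ I, e ⟨i, h⟩ = c then 1 else 0
  have hPP : P * Pᴴ = diagonal fun i => if i ∈ I then 1 else 0 := by
    ext i i'
    rw [Matrix.mul_apply]
    by_cases hi : i ∈ I
    · rw [Finset.sum_eq_single (e ⟨i, hi⟩)]
      · by_cases hii : i = i'
        · subst hii; simp [P, hi]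
        · rw [diagonal_apply_ne _ hii]
          have : ¬ ∃ h : i' ∈ I, e ⟨i', h⟩ = e ⟨i, hi⟩ := by
            rintro ⟨h, h'⟩
            exact hii (congrArg Subtype.val (e.injective h')).symm
          simp only [P, Matrix.conjTranspose_apply, Matrix.of_apply, if_neg this, star_zero,
            mul_zero]
      · intro c _ hc
        have : ¬ ∃ h : i ∈ I, e ⟨i, h⟩ = c := by
          rintro ⟨h, rfl⟩; exact hc rfl
        simp only [P, Matrix.of_apply, if_neg this, zero_mul]
      · simp
    · rw [Finset.sum_eq_zero]
      · by_cases hii : i = i'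
        · subst hii; simp [hi]
        · rw [diagonal_apply_ne _ hii]
      · intro c _
        have : ¬ ∃ h : i ∈ I, e ⟨i, h⟩ = c := fun ⟨h, _⟩ => hi h
        simp only [P, Matrix.of_apply, if_neg this, zero_mul]
  refine ⟨P, ?_, hPP⟩
  have h1 := Matrix.l2_opNorm_conjTranspose_mul_self Pᴴ
  rw [conjTranspose_conjTranspose, l2_opNorm_conjTranspose, hPP, l2_opNorm_diagonal] at h1
  have h2 : ‖fun i => if i ∈ I then (1 : ℂ) else 0‖ ≤ 1 :=
    (pi_norm_le_iff_of_nonneg zero_le_one).2 fun i => by split_ifs <;> simp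
  nlinarith [norm_nonneg P]

/-- A Hermitian matrix with a small even moment is, up to a matrix of small rank, bounded. -/
theorem exists_truncation {N k m : ℕ} {A : Matrix (Fin N) (Fin N) ℂ} (hA : A.IsHermitian)
    {r : ℝ} (hr : 0 < r) (htr : (A ^ (2 * m)).trace.re ≤ k * r ^ (2 * m)) :
    ∃ (Z : Matrix (Fin N) (Fin N) ℂ) (B : Matrix (Fin N) (Fin k) ℂ)
      (C : Matrix (Fin k) (Fin N) ℂ), Z.IsHermitian ∧ ‖B‖ ≤ 1 ∧ ‖C‖ ≤ ‖A‖ ∧ Z = B * C ∧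
        ‖A - Z‖ ≤ r := by
  obtain ⟨U, t, hUt⟩ := exists_unitary_diagonal hA
  set I : Finset (Fin N) := Finset.univ.filter fun i => r < |t i| with hIdef
  -- Markov's inequality for the eigenvalues.
  have hI : I.card ≤ k := by
    rw [hUt, trace_pow_unitary_conj, Complex.ofReal_re] at htr
    have h1 : ∑ i ∈ I, r ^ (2 * m) ≤ ∑ i, t i ^ (2 * m) := by
      refine (Finset.sum_le_sum fun i hi => ?_).trans
        (Finset.sum_le_univ_sum_of_nonneg fun i => Even.pow_nonneg (even_two_mul m) (t i))
      rw [← (even_two_mul m).pow_abs (t i)]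
      exact pow_le_pow_left₀ hr.le (Finset.mem_filter.1 hi).2.le _
    rw [Finset.sum_const, nsmul_eq_mul] at h1
    exact_mod_cast le_of_mul_le_mul_right (h1.trans htr) (by positivity)
  obtain ⟨P, hP, hPP⟩ := exists_partial_isometry I hI
  set z : Fin N → ℂ := fun i => if i ∈ I then (t i : ℂ) else 0 with hz
  have hPz : P * Pᴴ * diagonal z = diagonal z := by
    rw [hPP, diagonal_mul_diagonal]
    congr 1
    ext i
    by_cases hi : i ∈ I <;> simp [hz, hi]
  have hU1 : ‖U.1‖ ≤ 1 := by
    have := CStarRing.norm_mul_mem_unitary (1 : Matrix (Fin N) (Fin N) ℂ) U.2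
    rw [one_mul] at this
    rw [this]; exact norm_one_le_one N
  have hU2 : ‖star U.1‖ ≤ 1 := by rw [norm_star]; exact hU1
  have hAn : ‖A‖ = ‖fun i => (t i : ℂ)‖ := by rw [hUt, norm_unitary_conj_diagonal]
  have hzn : ‖z‖ ≤ ‖A‖ := by
    rw [hAn]
    refine (pi_norm_le_iff_of_nonneg (norm_nonneg _)).2 fun i => ?_
    by_cases hi : i ∈ I
    · simpa [hz, hi] using norm_le_pi_norm (fun i => (t i : ℂ)) i
    · simp [hz, hi]
  refine ⟨U.1 * diagonal z * star U.1, U.1 * P, Pᴴ * diagonal z * star U.1, ?_, ?_, ?_, ?_, ?_⟩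
  · have hd : (diagonal z).IsHermitian := isHermitian_diagonal_of_self_adjoint z (by
      ext i; by_cases hi : i ∈ I <;> simp [hz, hi])
    exact isHermitian_mul_mul_conjTranspose U.1 hd
  · exact (Matrix.l2_opNorm_mul _ _).trans (mul_le_one₀ hU1 (norm_nonneg _) hP)
  · refine (Matrix.l2_opNorm_mul _ _).trans (mul_le_of_le_one_right (norm_nonneg _) hU2 |>.trans ?_)
    refine (Matrix.l2_opNorm_mul _ _).trans ?_
    rw [l2_opNorm_conjTranspose, l2_opNorm_diagonal]
    exact (mul_le_of_le_one_left (norm_nonneg _) hP).trans hzn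
  · conv_lhs => rw [← hPz]
    simp only [Matrix.mul_assoc]
  · have e : A - U.1 * diagonal z * star U.1 =
        U.1 * diagonal (fun i => (t i : ℂ) - z i) * star U.1 := by
      conv_lhs => rw [hUt]
      rw [← Matrix.sub_mul, ← Matrix.mul_sub, diagonal_sub]
    rw [e, norm_unitary_conj_diagonal]
    refine (pi_norm_le_iff_of_nonneg hr.le).2 fun i => ?_
    by_cases hi : i ∈ I
    · simp [hz, hi, hr.le]
    · have : |t i| ≤ r := by
        by_contra! h; exact hi (Finset.mem_filter.2 ⟨Finset.mem_univ i, h⟩)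
      simpa [hz, hi] using this

/-! ### Independence of the cutoff -/

theorem volume_le_of_translates {N n : ℕ} {T S : Set (HermTuple N n)} (F : Finset (HermTuple N n))
    (h : ∀ Y ∈ T, ∃ Z ∈ F, Y - Z ∈ S) : volume T ≤ F.card * volume S := by
  have hsub : T ⊆ ⋃ Z ∈ F, (fun Y => Y - Z) ⁻¹' S := by
    intro Y hY
    obtain ⟨Z, hZ, hYZ⟩ := h Y hY
    exact Set.mem_biUnion hZ hYZ
  refine (measure_mono hsub).trans ((measure_biUnion_finset_le F _).trans (le_of_eq ?_))
  simp_rw [sub_eq_add_neg, measure_preimage_add_right]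
  rw [Finset.sum_const, nsmul_eq_mul]

theorem HermTuple.mat_sub {N n : ℕ} (Y Z : HermTuple N n) (j : Fin n) :
    (Y - Z).mat j = Y.mat j - Z.mat j := rfl

/-- A microstate with small even moments is, up to an element of a net of tuples of small rank,
bounded in operator norm and close in law. -/
theorem exists_net_translate {N n k m : ℕ} {L r : ℝ} (hL : 1 ≤ L) (hr : 0 < r)
    (hrL : r + 1 ≤ L) :
    ∃ F : Finset (HermTuple N n), (F.card : ℝ) ≤ (1 + 4 * L ^ 2) ^ (4 * n * k * N) ∧
      ∀ Y : HermTuple N n, Y.opNorm ≤ L →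
        (∀ j, (Y.mat j ^ (2 * m)).trace.re ≤ k * r ^ (2 * m)) →
        ∃ Z ∈ F, (Y - Z).opNorm ≤ r + 1 ∧ ∀ w : FreeMonoid (Fin n),
          ‖matLaw Y (ncWord w) - matLaw (Y - Z) (ncWord w)‖ ≤
            k / N * (w.length * L ^ (w.length + 1)) := by
  have hL0 : 0 < L := zero_lt_one.trans_le hL
  obtain ⟨F, hF, hcard, hnet⟩ := exists_finite_net_factorsThrough N n k hL0
  refine ⟨F, hcard, fun Y hY hmom => ?_⟩
  have hYj := (Y.opNorm_le_iff hL0.le).1 hY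
  choose Z₀ B C hZ₀ hB hC hBC hYZ using fun j =>
    exists_truncation (Y.mat_isHermitian j) hr (hmom j)
  obtain ⟨Z, hZF, hZ⟩ := hnet (fun j => ⟨Z₀ j, hZ₀ j⟩)
    ⟨B, C, fun j => ⟨(hB j).trans hL, (hC j).trans (hYj j), hBC j⟩⟩
  obtain ⟨A', B', hAB⟩ := hF Z hZF
  have hW : ∀ j, ‖(Y - Z).mat j‖ ≤ r + 1 := by
    intro j
    have e : (Y - Z).mat j = (Y.mat j - Z₀ j) + (Z₀ j - Z.mat j) := by
      rw [HermTuple.mat_sub]; abel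
    rw [e]
    exact (norm_add_le _ _).trans (add_le_add (hYZ j) (hZ j))
  refine ⟨Z, hZF, ((Y - Z).opNorm_le_iff (by linarith)).2 hW, fun w => ?_⟩
  have h := norm_trace_lift_sub_le (Y := Y.mat) (W := (Y - Z).mat) hYj
    (fun j => (hW j).trans hrL) (fun j => (hAB j).1) (fun j => (hAB j).2.1)
    (fun j => by rw [HermTuple.mat_sub, sub_sub_cancel]; exact (hAB j).2.2) w 1
  rw [one_mul, Matrix.trace_sub, mul_sub] at h
  rw [matLaw_ncWord, matLaw_ncWord]
  refine h.trans (mul_le_mul_of_nonneg_left ?_ (by positivity))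
  exact mul_le_of_le_one_left (by positivity) (norm_one_le_one N)

theorem normLogVolume_le_add {n N : ℕ} {R R' : ℝ} {𝒰 : Set (lawSpace n R)}
    {𝒰' : Set (lawSpace n R')} {c : ℝ} {q : ℕ} {e : ℝ} (hc : 1 ≤ c) {b : ℕ} (hb : (b : ℝ) ≤ c ^ q)
    (hq : ((N : ℝ) ^ 2)⁻¹ * (q * Real.log c) ≤ e)
    (h : volume (microstateSpace 𝒰' N) ≤ b * volume (microstateSpace 𝒰 N)) {a : ℝ} (hN : 0 < N)
    (ha : normLogVolume 𝒰 N < a) : normLogVolume 𝒰' N ≤ ((a + e : ℝ) : EReal) := by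
  have hN' : (0 : ℝ) < N := Nat.cast_pos.2 hN
  by_cases h0 : volume (microstateSpace 𝒰' N) = 0
  · rw [normLogVolume, h0, ENNReal.log_zero, EReal.coe_mul_bot_of_pos (by positivity),
      EReal.bot_add]
    exact bot_le
  have h1 : volume (microstateSpace 𝒰 N) ≠ 0 := fun hz => h0 (by simpa [hz] using h)
  have t0 := volume_microstateSpace_ne_top 𝒰' N
  have t1 := volume_microstateSpace_ne_top 𝒰 N
  have p0 := ENNReal.toReal_pos h0 t0
  have p1 := ENNReal.toReal_pos h1 t1
  rw [normLogVolume, ENNReal.log_pos_real h1 t1, ← EReal.coe_mul, ← EReal.coe_add,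
    EReal.coe_lt_coe_iff] at ha
  rw [normLogVolume, ENNReal.log_pos_real h0 t0, ← EReal.coe_mul, ← EReal.coe_add,
    EReal.coe_le_coe_iff]
  have h2 : (volume (microstateSpace 𝒰' N)).toReal ≤
      c ^ q * (volume (microstateSpace 𝒰 N)).toReal := by
    have := ENNReal.toReal_mono (ENNReal.mul_ne_top (ENNReal.natCast_ne_top b) t1) h
    rw [ENNReal.toReal_mul, ENNReal.toReal_natCast] at this
    exact this.trans (mul_le_mul_of_nonneg_right hb p1.le)
  have h3 := Real.log_le_log p0 h2
  rw [Real.log_mul (by positivity) p1.ne', Real.log_pow] at h3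
  have h4 := mul_le_mul_of_nonneg_left h3 (show (0 : ℝ) ≤ ((N : ℝ) ^ 2)⁻¹ by positivity)
  rw [mul_add] at h4
  linarith

theorem exists_two_mul_pow_lt {ρ r ε : ℝ} (hρ : 0 < ρ) (hr : ρ < r) (hε : 0 < ε) :
    ∃ m : ℕ, 2 * ρ ^ (2 * m) ≤ ε * r ^ (2 * m) := by
  have hr0 : 0 < r := hρ.trans hr
  have h1 : 1 < (r / ρ) ^ 2 := one_lt_pow₀ ((one_lt_div hρ).2 hr) two_ne_zero
  obtain ⟨m, hm⟩ := pow_unbounded_of_one_lt (2 / ε) h1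
  refine ⟨m, ?_⟩
  rw [← pow_mul, div_pow, div_lt_div_iff₀ hε (by positivity)] at hm
  linarith

/-- Cutting off at `ρ + 2` a functional of radius `ρ` does not lose entropy. -/
theorem chiR_le_chiR {n : ℕ} {lam : NCFunctional n} {ρ R' : ℝ} (hρ : 0 < ρ)
    (hlam : lam ∈ lawSpace n ρ) (hlam₂ : lam ∈ lawSpace n (ρ + 2)) (hR' : 0 < R')
    (hlam' : lam ∈ lawSpace n R') :
    chiR (⟨lam, hlam'⟩ : lawSpace n R') ≤ chiR (⟨lam, hlam₂⟩ : lawSpace n (ρ + 2)) := by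
  classical
  rw [chiR_eq_iInf (⟨lam, hlam₂⟩ : lawSpace n (ρ + 2))]
  refine le_iInf fun 𝒰 => le_iInf fun h𝒰 => le_iInf fun hmem => ?_
  rw [← EReal.le_of_forall_lt_iff_le]
  intro a ha
  have hev := eventually_lt_of_limsup_lt ha
  obtain ⟨V, hV, rfl⟩ := isOpen_induced_iff.1 h𝒰
  obtain ⟨F, η, hη, hFV⟩ := exists_wordNhd_subset hV hmem
  -- Bounds both the given microstates and their truncations.
  set L := max R' (ρ + 2) with hLdef
  have hL2 : ρ + 2 ≤ L := le_max_right _ _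
  have hL1 : 1 ≤ L := by linarith
  set c := 1 + 4 * L ^ 2 with hcdef
  have hc : 1 ≤ c := by nlinarith
  have hlogc : 0 ≤ Real.log c := Real.log_nonneg hc
  set D := ∑ w ∈ F, (w.length * L ^ (w.length + 1) : ℝ) + 1 with hDdef
  have hD0 : ∀ w : FreeMonoid (Fin n), (0 : ℝ) ≤ w.length * L ^ (w.length + 1) := fun w => by
    positivity
  have hD : 0 < D := by
    have := Finset.sum_nonneg fun w (_ : w ∈ F) => hD0 w
    linarith
  have hwD : ∀ w ∈ F, (w.length * L ^ (w.length + 1) : ℝ) ≤ D := fun w hw => by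
    have := Finset.single_le_sum (fun w (_ : w ∈ F) => hD0 w) hw
    linarith
  have key : ∀ ε : ℝ, 0 < ε → ε < 1 → ε * D ≤ η / 2 →
      chiR (⟨lam, hlam'⟩ : lawSpace n R') ≤ ((a + ε * (4 * n * Real.log c) : ℝ) : EReal) := by
    intro ε hε hε1 hεD
    -- With the `2m`-th moment at most `2 ρ ^ (2m)`, at most a fraction `ε / 2` of the eigenvalues
    -- exceeds `ρ + 1`; the other half of `ε` absorbs the floor in `k`.
    obtain ⟨m, hm⟩ := exists_two_mul_pow_lt hρ (show ρ < ρ + 1 by linarith) (half_pos hε)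
    set F' := F ∪ Finset.univ.image fun j : Fin n => FreeMonoid.of j ^ (2 * m) with hF'
    -- One half of `η` is left for the change of law under truncation; `ρ ^ (2m)` keeps the moments
    -- below `2 ρ ^ (2m)`.
    set η' := min (η / 2) (ρ ^ (2 * m)) with hη'
    have hη'0 : 0 < η' := lt_min (half_pos hη) (by positivity)
    set V' := wordNhd lam F' η' with hV'
    have hle : chiR (⟨lam, hlam'⟩ : lawSpace n R') ≤
        limsup (normLogVolume ((Subtype.val : lawSpace n R' → NCFunctional n) ⁻¹' V')) atTop := by
      rw [chiR_eq_iInf]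
      exact iInf_le_of_le _ (iInf_le_of_le ((isOpen_wordNhd lam F' η').preimage
        continuous_subtype_val) (iInf_le _ (mem_wordNhd_self lam F' hη'0)))
    refine hle.trans (limsup_le_of_le (h := ?_))
    have hlarge : ∀ᶠ N : ℕ in atTop, 2 / ε ≤ (N : ℝ) :=
      tendsto_natCast_atTop_atTop.eventually_ge_atTop _
    filter_upwards [hev, hlarge, eventually_gt_atTop 0] with N hN hNε hN0
    have hN0' : (0 : ℝ) < N := Nat.cast_pos.2 hN0
    set k := ⌊ε * N⌋₊ with hkdef
    have hk1 : (k : ℝ) ≤ ε * N := Nat.floor_le (by positivity)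
    have hk2 : ε / 2 * N ≤ k := by
      have h1 := Nat.lt_floor_add_one (ε * N)
      rw [div_le_iff₀ hε] at hNε
      rw [← hkdef] at h1
      linarith
    have hkN' : (k : ℝ) / N ≤ ε := by rwa [div_le_iff₀ hN0']
    obtain ⟨G, hG, hnet⟩ := exists_net_translate (N := N) (n := n) (k := k) (m := m) hL1
      (show 0 < ρ + 1 by linarith) (show ρ + 1 + 1 ≤ L by linarith)
    refine normLogVolume_le_add hc hG ?_ (volume_le_of_translates G ?_) hN0 hN
    · push_cast
      have : ((N : ℝ) ^ 2)⁻¹ * (4 * n * k * N * Real.log c) =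
          k / N * (4 * n * Real.log c) := by field_simp
      rw [this]
      exact mul_le_mul_of_nonneg_right hkN' (by positivity)
    · intro Y hY
      rw [microstateSpace_preimage] at hY
      obtain ⟨hYlaw, hYV⟩ := hY
      have hYop : Y.opNorm ≤ L :=
        (HermTuple.opNorm_le_of_matLaw_mem hN0 hR' hYlaw).trans (le_max_left _ _)
      have hmom : ∀ j, (Y.mat j ^ (2 * m)).trace.re ≤ k * (ρ + 1) ^ (2 * m) := by
        intro j
        have h1 := hYV (FreeMonoid.of j ^ (2 * m)) (Finset.mem_union_right _
          (Finset.mem_image_of_mem _ (Finset.mem_univ j)))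
        have h2 := hlam.2.2 (FreeMonoid.of j ^ (2 * m))
        rw [length_of_pow] at h2
        have h3 : ‖matLaw Y (ncWord (FreeMonoid.of j ^ (2 * m)))‖ ≤ 2 * ρ ^ (2 * m) := by
          have := norm_le_norm_sub_add (matLaw Y (ncWord (FreeMonoid.of j ^ (2 * m))))
            (lam (ncWord (FreeMonoid.of j ^ (2 * m))))
          have h4 := h1.le.trans (min_le_right _ _)
          linarith
        rw [matLaw_ncWord, lift_of_pow, norm_mul, norm_inv, Complex.norm_natCast,
          inv_mul_le_iff₀ hN0'] at h3
        refine (Complex.re_le_norm _).trans (h3.trans ?_)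
        calc (N : ℝ) * (2 * ρ ^ (2 * m)) ≤ N * (ε / 2 * (ρ + 1) ^ (2 * m)) :=
              mul_le_mul_of_nonneg_left hm hN0'.le
          _ = (ε / 2 * N) * (ρ + 1) ^ (2 * m) := by ring
          _ ≤ _ := mul_le_mul_of_nonneg_right hk2 (by positivity)
      obtain ⟨Z, hZ, hop, hlaw⟩ := hnet Y hYop hmom
      refine ⟨Z, hZ, ?_⟩
      rw [microstateSpace_preimage]
      refine ⟨HermTuple.matLaw_mem_lawSpace (by linarith) (hop.trans (by linarith)), hFV ?_⟩
      intro w hw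
      have h1 := hYV w (Finset.mem_union_left _ hw)
      have h2 := (hlaw w).trans (mul_le_mul hkN' (hwD w hw) (hD0 w) hε.le)
      rw [norm_sub_rev] at h2
      have h3 := norm_sub_le_norm_sub_add_norm_sub (matLaw (Y - Z) (ncWord w))
        (matLaw Y (ncWord w)) (lam (ncWord w))
      have h4 := h1.trans_le (min_le_left _ _)
      linarith
  have hlim : Tendsto (fun ε : ℝ => ((a + ε * (4 * n * Real.log c) : ℝ) : EReal)) (𝓝[>] 0)
      (𝓝 (a : EReal)) := by
    refine (continuous_coe_real_ereal.tendsto a).comp (tendsto_nhdsWithin_of_tendsto_nhds ?_)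
    have : Continuous fun ε : ℝ => a + ε * (4 * n * Real.log c) := by fun_prop
    simpa using this.tendsto 0
  refine ge_of_tendsto hlim ?_
  have h1 : ∀ᶠ ε : ℝ in 𝓝[>] 0, ε < min 1 (η / 2 / D) :=
    nhdsWithin_le_nhds (gt_mem_nhds (lt_min one_pos (by positivity)))
  filter_upwards [h1, self_mem_nhdsWithin] with ε hε hε0
  refine key ε hε0 (hε.trans_le (min_le_left _ _)) ?_
  exact (le_div_iff₀ hD).1 (hε.le.trans (min_le_right _ _))

theorem chi_eq_chiR {n : ℕ} {lam : NCFunctional n} {ρ : ℝ} (hρ : 0 < ρ)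
    (hlam : lam ∈ lawSpace n ρ) (hlam₂ : lam ∈ lawSpace n (ρ + 2)) :
    chi lam = chiR (⟨lam, hlam₂⟩ : lawSpace n (ρ + 2)) := by
  refine le_antisymm (iSup_le fun R' => iSup_le fun hR' => iSup_le fun h =>
    chiR_le_chiR hρ hlam hlam₂ hR' h) ?_
  exact le_iSup_of_le (ρ + 2) (le_iSup_of_le (by linarith)
    (le_iSup (fun h => chiR (⟨lam, h⟩ : lawSpace n (ρ + 2))) hlam₂))

/-! ### Unitary invariance -/

theorem lift_unitaryConj {N n : ℕ} (U : Matrix.unitaryGroup (Fin N) ℂ) (Y : HermTuple N n)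
    (w : FreeMonoid (Fin n)) : FreeMonoid.lift (Y.unitaryConj U).mat w =
      U.1 * FreeMonoid.lift Y.mat w * star U.1 := by
  have hU : star U.1 * U.1 = 1 := Unitary.coe_star_mul_self U
  have hU' : U.1 * star U.1 = 1 := Unitary.coe_mul_star_self U
  induction w using FreeMonoid.inductionOn' with
  | one => simp only [map_one, mul_one, hU']
  | of_mul i w ih =>
    rw [map_mul, map_mul, ih, FreeMonoid.lift_eval_of, FreeMonoid.lift_eval_of]
    calc U.1 * Y.mat i * star U.1 * (U.1 * FreeMonoid.lift Y.mat w * star U.1) =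
          U.1 * Y.mat i * (star U.1 * U.1) * FreeMonoid.lift Y.mat w * star U.1 := by
          simp only [mul_assoc]
      _ = _ := by rw [hU, mul_one]; simp only [mul_assoc]

theorem trace_unitary_conj {N : ℕ} (U : Matrix.unitaryGroup (Fin N) ℂ)
    (A : Matrix (Fin N) (Fin N) ℂ) : (U.1 * A * star U.1).trace = A.trace := by
  have hU : star U.1 * U.1 = 1 := Unitary.coe_star_mul_self U
  rw [Matrix.trace_mul_comm, ← mul_assoc, hU, one_mul]

theorem matLaw_unitaryConj {N n : ℕ} (U : Matrix.unitaryGroup (Fin N) ℂ) (Y : HermTuple N n) :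
    matLaw (Y.unitaryConj U) = matLaw Y := by
  refine LinearMap.ext fun p => ?_
  rw [NCFunctional.apply_eq_sum, NCFunctional.apply_eq_sum (matLaw Y)]
  refine Finset.sum_congr rfl fun w _ => ?_
  rw [matLaw_ncWord, matLaw_ncWord, lift_unitaryConj, trace_unitary_conj]

theorem norm_unitaryConj {N n : ℕ} (U : Matrix.unitaryGroup (Fin N) ℂ) (Y : HermTuple N n) :
    ‖Y.unitaryConj U‖ = ‖Y‖ := by
  refine (pow_left_inj₀ (norm_nonneg _) (norm_nonneg _) two_ne_zero).1 ?_
  rw [HermTuple.norm_sq_eq, HermTuple.norm_sq_eq]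
  refine Finset.sum_congr rfl fun j _ => ?_
  have h := lift_unitaryConj U Y (FreeMonoid.of j ^ 2)
  rw [lift_of_pow, lift_of_pow, pow_two, pow_two] at h
  rw [h, trace_unitary_conj]

/-- Conjugation is a linear isometry of the inner product space. -/
theorem measurePreserving_unitaryConj {N n : ℕ} (U : Matrix.unitaryGroup (Fin N) ℂ) :
    MeasurePreserving (HermTuple.unitaryConj U : HermTuple N n → HermTuple N n) := by
  let f : HermTuple N n →ₗᵢ[ℝ] HermTuple N n :=
    { toFun := HermTuple.unitaryConj U
      map_add' := fun X Y => HermTuple.ext_mat fun j =>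
        show U.1 * (X.mat j + Y.mat j) * star U.1 =
          U.1 * X.mat j * star U.1 + U.1 * Y.mat j * star U.1 by
          rw [Matrix.mul_add, Matrix.add_mul]
      map_smul' := fun r Y => HermTuple.ext_mat fun j =>
        show U.1 * (r • Y.mat j) * star U.1 = r • (U.1 * Y.mat j * star U.1) by
          rw [Matrix.mul_smul, Matrix.smul_mul]
      norm_map' := norm_unitaryConj U }
  exact (f.toLinearIsometryEquiv rfl).measurePreserving

theorem isUnitarilyInvariant_cond_microstateSpace {n N : ℕ} {R : ℝ} {𝒰 : Set (lawSpace n R)}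
    (h𝒰 : IsOpen 𝒰) : IsUnitarilyInvariant
      (ProbabilityTheory.cond volume (microstateSpace 𝒰 N)) := by
  intro U
  have hpre : HermTuple.unitaryConj U ⁻¹' microstateSpace 𝒰 N = microstateSpace 𝒰 N := by
    ext Y
    simp only [microstateSpace, Set.mem_preimage, Set.mem_ofPred_eq, matLaw_unitaryConj]
  have h := (measurePreserving_unitaryConj U).restrict_preimage
    (measurableSet_microstateSpace h𝒰 N)
  rw [hpre] at h
  rw [ProbabilityTheory.cond, Measure.map_smul, h.map_eq]

/-! ### Uniform distributions on microstate spaces -/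

theorem normEntropy_cond_microstateSpace {n N : ℕ} {R : ℝ} {𝒰 : Set (lawSpace n R)}
    (h𝒰 : IsOpen 𝒰) (h0 : volume (microstateSpace 𝒰 N) ≠ 0) :
    normEntropy (ProbabilityTheory.cond volume (microstateSpace 𝒰 N)) = normLogVolume 𝒰 N := by
  rw [normEntropy, entropy_cond (measurableSet_microstateSpace h𝒰 N) h0
    (volume_microstateSpace_ne_top 𝒰 N), normLogVolume]

theorem cond_compl_self_eq_zero {H : Type*} [MeasurableSpace H] {ν : Measure H} {S : Set H}
    (hS : MeasurableSet S) : ProbabilityTheory.cond ν S Sᶜ = 0 := by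
  rw [ProbabilityTheory.cond_apply hS, Set.inter_compl_self, measure_empty, mul_zero]

/-- There are countably many words, hence a countable neighbourhood basis. -/
theorem exists_seq_wordNhd {n : ℕ} (lam : NCFunctional n) :
    ∃ W : ℕ → Set (NCFunctional n), (∀ m, IsOpen (W m)) ∧ (∀ m, lam ∈ W m) ∧
      ∀ V, IsOpen V → lam ∈ V → ∀ᶠ m in atTop, W m ⊆ V := by
  classical
  have : Countable (FreeMonoid (Fin n)) := inferInstanceAs (Countable (List (Fin n)))
  obtain ⟨g, hg⟩ := exists_surjective_nat (FreeMonoid (Fin n))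
  refine ⟨fun m => wordNhd lam ((Finset.range m).image g) (1 / ((m : ℝ) + 1)),
    fun m => isOpen_wordNhd _ _ _, fun m => mem_wordNhd_self _ _ (by positivity),
    fun V hV hlam => ?_⟩
  obtain ⟨F, η, hη, hFV⟩ := exists_wordNhd_subset hV hlam
  have h1 : ∀ᶠ m : ℕ in atTop, 1 / ((m : ℝ) + 1) < η :=
    tendsto_one_div_add_atTop_nhds_zero_nat.eventually (gt_mem_nhds hη)
  have h2 : ∀ᶠ m : ℕ in atTop, ∀ w ∈ F, w ∈ (Finset.range m).image g := by
    rw [Filter.eventually_all_finset]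
    intro w _
    obtain ⟨i, rfl⟩ := hg w
    filter_upwards [eventually_gt_atTop i] with m hm
    exact Finset.mem_image_of_mem g (Finset.mem_range.2 hm)
  filter_upwards [h1, h2] with m hm1 hm2
  exact fun κ hκ => hFV fun w hw => (hκ w (hm2 w hw)).trans hm1

/-- Uniform distributions on microstate spaces of shrinking neighbourhoods, along sizes where the
volume beats a sequence increasing to `chiR`. An infinite value needs no separate treatment. -/
theorem exists_matrixModel_chiR_le {n : ℕ} {lam : NCFunctional n} {R : ℝ} (hR : 0 < R)
    (hlam : lam ∈ lawSpace n R) (hbot : chiR (⟨lam, hlam⟩ : lawSpace n R) ≠ ⊥) :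
    ∃ (N : ℕ → ℕ) (μ : (l : ℕ) → Measure (HermTuple (N l) n)), IsMatrixModel lam N μ ∧
      (∀ l, ∀ᵐ Y ∂(μ l), Y.opNorm ≤ R) ∧ (∀ l, IsUnitarilyInvariant (μ l)) ∧
      chiR (⟨lam, hlam⟩ : lawSpace n R) ≤ limsup (fun l => normEntropy (μ l)) atTop := by
  obtain ⟨W, hWo, hWmem, hW⟩ := exists_seq_wordNhd lam
  obtain ⟨u, -, hu, hut⟩ := exists_seq_strictMono_tendsto' (bot_lt_iff_ne_bot.2 hbot)
  set 𝒰 : ℕ → Set (lawSpace n R) := fun m => Subtype.val ⁻¹' W m with h𝒰def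
  have h𝒰 : ∀ m, IsOpen (𝒰 m) := fun m => (hWo m).preimage continuous_subtype_val
  -- The limsup exceeds `u m`, so this happens for arbitrarily large `N`; `m + 1 ≤ N` forces the
  -- sizes to infinity.
  have hex : ∀ m, ∃ N, m + 1 ≤ N ∧ u m < normLogVolume (𝒰 m) N := by
    intro m
    have h1 : chiR (⟨lam, hlam⟩ : lawSpace n R) ≤ limsup (normLogVolume (𝒰 m)) atTop := by
      rw [chiR_eq_iInf]
      exact iInf_le_of_le (𝒰 m) (iInf_le_of_le (h𝒰 m) (iInf_le _ (hWmem m)))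
    have h2 := frequently_lt_of_lt_limsup (hu := isCobounded_le_of_bot)
      (lt_of_lt_of_le (hu m).2 h1)
    exact (h2.and_eventually (eventually_ge_atTop (m + 1))).exists.imp fun N h => ⟨h.2, h.1⟩
  choose N hNm hNu using hex
  have hN0 : ∀ m, 0 < N m := fun m => (Nat.succ_pos m).trans_le (hNm m)
  set S : (m : ℕ) → Set (HermTuple (N m) n) := fun m => microstateSpace (𝒰 m) (N m) with hSdef
  have hSm : ∀ m, MeasurableSet (S m) := fun m => measurableSet_microstateSpace (h𝒰 m) (N m)
  have hS0 : ∀ m, volume (S m) ≠ 0 := by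
    intro m h0
    have h1 := hNu m
    have h2 : (0 : ℝ) < N m := Nat.cast_pos.2 (hN0 m)
    rw [normLogVolume, h0, ENNReal.log_zero, EReal.coe_mul_bot_of_pos (by positivity),
      EReal.bot_add] at h1
    exact not_lt_bot h1
  have hSlaw : ∀ m, ∀ Y ∈ S m, matLaw Y ∈ lawSpace n R ∧ matLaw Y ∈ W m := by
    intro m Y hY
    rw [hSdef] at hY
    simp only [h𝒰def, microstateSpace_preimage] at hY
    exact hY
  have hSop : ∀ m, ∀ Y ∈ S m, Y.opNorm ≤ R := fun m Y hY =>
    HermTuple.opNorm_le_of_matLaw_mem (hN0 m) hR (hSlaw m Y hY).1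
  have hSnorm : ∀ m, ∀ Y ∈ S m, ‖Y‖ ≤ Real.sqrt (n * R ^ 2) := fun m Y hY =>
    Real.le_sqrt_of_sq_le (HermTuple.norm_sq_le_of_matLaw_mem (hSlaw m Y hY).1)
  have hnull : ∀ m (T : Set (HermTuple (N m) n)), (∀ Y ∈ S m, Y ∉ T) →
      ProbabilityTheory.cond volume (S m) T = 0 := fun m T hT =>
    measure_mono_null (fun Y hY hYS => hT Y hYS hY) (cond_compl_self_eq_zero (hSm m))
  refine ⟨N, fun m => ProbabilityTheory.cond volume (S m), ?_, ?_, ?_, ?_⟩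
  · refine ⟨hN0, ?_, ?_, ?_, ?_, ?_⟩
    · exact tendsto_atTop_mono (fun m => (Nat.le_succ m).trans (hNm m)) tendsto_id
    · exact fun m => ProbabilityTheory.cond_isProbabilityMeasure_of_finite (hS0 m)
        (volume_microstateSpace_ne_top _ _)
    · intro V hV hlamV
      refine tendsto_const_nhds.congr' ?_
      filter_upwards [hW V hV hlamV] with m hm
      exact (hnull m {Y | matLaw Y ∉ V} fun Y hY hYV => hYV (hm (hSlaw m Y hY).2)).symm
    · refine ⟨R, hR, fun ε hε => tendsto_const_nhds.congr fun m => (hnull m _ ?_).symm⟩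
      intro Y hY hYR
      have h1 : R + ε ≤ Y.opNorm := hYR
      linarith [hSop m Y hY]
    -- Beyond this constant the tails are empty, so any `K` works; the `1` keeps it positive even
    -- for `n = 0`.
    · refine ⟨Real.sqrt (n * R ^ 2) + 1, 1, by positivity, one_pos, fun m δ hδ => ?_⟩
      rw [hnull m]
      · exact zero_le
      · intro Y hY hYR
        have h1 : Real.sqrt (n * R ^ 2) + 1 + δ ≤ ‖Y‖ := hYR
        linarith [hSnorm m Y hY]
  · intro m
    rw [ae_iff]
    exact hnull m _ fun Y hY h => h (hSop m Y hY)
  · exact fun m => isUnitarilyInvariant_cond_microstateSpace (h𝒰 m)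
  · rw [← hut.limsup_eq]
    refine limsup_le_limsup (Eventually.of_forall fun m => ?_)
    change u m ≤ normEntropy (ProbabilityTheory.cond volume (microstateSpace (𝒰 m) (N m)))
    rw [normEntropy_cond_microstateSpace (h𝒰 m) (hS0 m)]
    exact (hNu m).le

/-- The supremum of the limiting entropies of matrix models is attained. -/
theorem exists_matrixModel_limsup_eq_chi {n : ℕ} {lam : NCFunctional n}
    (hlam : ∃ ρ > 0, lam ∈ lawSpace n ρ) (hbot : chi lam ≠ ⊥) :
    ∃ (N : ℕ → ℕ) (μ : (l : ℕ) → Measure (HermTuple (N l) n)), IsMatrixModel lam N μ ∧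
      (∃ R : ℝ, ∀ l, ∀ᵐ Y ∂(μ l), Y.opNorm ≤ R) ∧ (∀ l, IsUnitarilyInvariant (μ l)) ∧
      limsup (fun l => normEntropy (μ l)) atTop = chi lam := by
  obtain ⟨ρ, hρ, h⟩ := hlam
  have h2 : lam ∈ lawSpace n (ρ + 2) := lawSpace_mono hρ.le (by linarith) h
  have hchi := chi_eq_chiR hρ h h2
  obtain ⟨N, μ, hμ, hop, hinv, hle⟩ := exists_matrixModel_chiR_le (by linarith) h2 (hchi ▸ hbot)
  exact ⟨N, μ, hμ, ⟨_, hop⟩, hinv,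
    le_antisymm (hμ.limsup_normEntropy_le_chi ⟨ρ, hρ, h⟩) (hchi.trans_le hle)⟩

end Microstates

end

/-! ### Microstates free entropy as a supremum over random matrix models -/

theorem propositionB5 {A : Type*} [Ring A] [StarRing A] [Algebra ℂ A] [StarModule ℂ A]
    (τ : A →ₗ[ℂ] ℂ) (hτ : Microstates.IsTracialState τ)
    {n : ℕ} (hn : 1 ≤ n) (X : Fin n → A) (hX : ∀ j, IsSelfAdjoint (X j))
    (hbdd : ∀ j, ∃ R : ℝ, Microstates.OpNormLE τ (X j) R) :
    IsLUB {c : EReal | ∃ (N : ℕ → ℕ)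
        (μ : (l : ℕ) → MeasureTheory.Measure (Microstates.HermTuple (N l) n)),
        Microstates.IsMatrixModel (Microstates.ncLaw τ X) N μ ∧
        c = Filter.limsup (fun l => Microstates.normEntropy (μ l)) Filter.atTop}
      (Microstates.chi (Microstates.ncLaw τ X)) ∧
    (Microstates.chi (Microstates.ncLaw τ X) ≠ ⊥ →
      ∃ (N : ℕ → ℕ) (μ : (l : ℕ) → MeasureTheory.Measure (Microstates.HermTuple (N l) n)),
        Microstates.IsMatrixModel (Microstates.ncLaw τ X) N μ ∧
        (∃ R : ℝ, ∀ l, ∀ᵐ Y ∂(μ l), Y.opNorm ≤ R) ∧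
        (∀ l, Microstates.IsUnitarilyInvariant (μ l)) ∧
        Filter.limsup (fun l => Microstates.normEntropy (μ l)) Filter.atTop =
          Microstates.chi (Microstates.ncLaw τ X)) := by
  have hlaw := hτ.exists_ncLaw_mem_lawSpace hX hbdd
  have hub : ∀ (N : ℕ → ℕ)
      (μ : (l : ℕ) → MeasureTheory.Measure (Microstates.HermTuple (N l) n)),
      Microstates.IsMatrixModel (Microstates.ncLaw τ X) N μ →
      Filter.limsup (fun l => Microstates.normEntropy (μ l)) Filter.atTop ≤
        Microstates.chi (Microstates.ncLaw τ X) := fun N μ hμ =>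
    hμ.limsup_normEntropy_le_chi hlaw
  refine ⟨⟨?_, fun b hb => ?_⟩, Microstates.exists_matrixModel_limsup_eq_chi hlaw⟩
  · rintro c ⟨N, μ, hμ, rfl⟩
    exact hub N μ hμ
  · by_cases hbot : Microstates.chi (Microstates.ncLaw τ X) = ⊥
    · rw [hbot]; exact bot_le
    · obtain ⟨N, μ, hμ, -, -, hlim⟩ := Microstates.exists_matrixModel_limsup_eq_chi hlaw hbot
      rw [← hlim]
      exact hb ⟨N, μ, hμ, rfl⟩
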